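/- Let $N\ge 1$ and let $P:\mathbb R^2\to\mathbb R$ be an admissible homogeneous polynomial of degree $N+1$, that is, a real homogeneous polynomial of degree $N+1$ in two variables whose only critical point is the origin: $\nabla P(\xi)=0$ if and only if $\xi=0$. Let $M$ be the number of nodal lines of $P$, i.e. of lines through the origin on which $P$ vanishes identically. Then $M$ is finite, $M\le N+1$, and the following hold. (i) For every $\eta_0\in\mathbb R^2$ there is $R_0>0$ such that for every $R\ge R_0$ one has $\eta_0\notin\nabla P(\partial B_R(0))$ and the Brouwer degree of $\nabla P$ on the open disk $B_R(0)$ at the value $\eta_0$ is $$\deg(\nabla P,B_R(0),\eta_0)=1-M.$$ (ii) For almost every $\eta_0\in\mathbb R^2$ (with respect to Lebesgue measure) the equation $\nabla P(\xi)=\eta_0$ has at least $|1-M|$ distinct stable solutions. (iii) If $N=2$, then for every $\eta_0\ne0$ the equation $\nabla P(\xi)=\eta_0$ has at least $|1-M|$ distinct stable solutions. Here, for a continuous map $Z:\mathbb R^n\to\mathbb R^n$, a solution $x_0$ of $Z(x)=y$ is called stable if for every $\delta>0$ there is $\varepsilon>0$ such that every continuous $W:\mathbb R^n\to\mathbb R^n$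 with $\sup_{\mathbb R^n}|W-Z|\le\varepsilon$ has a point $x$ with $W(x)=y$ and $|x-x_0|<\delta$. -/

import Mathlib

open MeasureTheory Metric
open scoped ContDiff

noncomputable section

/-- `g` is an admissible smooth approximation of `f` on `closure U` for computing the degree at `y`:
`g` is smooth, `sup_{closure U} |g - f| < dist (y, f (∂U))`, and `y` is a regular value of `g` on
`U`. -/
structure IsRegularApprox {n : ℕ}
    (f : EuclideanSpace ℝ (Fin n) → EuclideanSpace ℝ (Fin n))
    (U : Set (EuclideanSpace ℝ (Fin n))) (y : EuclideanSpace ℝ (Fin n))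
    (g : EuclideanSpace ℝ (Fin n) → EuclideanSpace ℝ (Fin n)) : Prop where
  smooth : ContDiff ℝ ∞ g
  close : ∀ x ∈ closure U, ∀ z ∈ frontier U, ‖g x - f x‖ < ‖f z - y‖
  regular : ∀ x ∈ U, g x = y → (fderiv ℝ g x).det ≠ 0

/-- The signed number of preimages of `y` under `g` in `U`, i.e. the sum of the signs of the
Jacobian determinants of `g` at the solutions of `g x = y` in `U`. -/
def signedCount {n : ℕ}
    (g : EuclideanSpace ℝ (Fin n) → EuclideanSpace ℝ (Fin n))
    (U : Set (EuclideanSpace ℝ (Fin n))) (y : EuclideanSpace ℝ (Fin n)) : ℤ :=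
  ∑ᶠ x ∈ {x | x ∈ U ∧ g x = y}, ((SignType.sign (fderiv ℝ g x).det : SignType) : ℤ)

/-- The Brouwer degree `deg (f, U, y)` is defined and equal to `d`: `U` is bounded and open, `f` is
continuous on `closure U`, `y ∉ f (∂U)`, and `d` is the common value of the signed number of
preimages of `y` in `U` over all smooth approximations `g` of `f` having `y` as a regular value and
satisfying `sup_{closure U} |g - f| < dist (y, f (∂U))` (of which there is at least one). -/
structure HasBrouwerDegree {n : ℕ}
    (f : EuclideanSpace ℝ (Fin n) → EuclideanSpace ℝ (Fin n))
    (U : Set (EuclideanSpace ℝ (Fin n))) (y : EuclideanSpace ℝ (Fin n)) (d : ℤ) : Prop where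
  isOpen : IsOpen U
  isBounded : Bornology.IsBounded U
  continuousOn : ContinuousOn f (closure U)
  notMem : y ∉ f '' frontier U
  exists_approx : ∃ g, IsRegularApprox f U y g
  eq_signedCount : ∀ g, IsRegularApprox f U y g → signedCount g U y = d

/-- The degree is unique when it is defined. -/
theorem HasBrouwerDegree.unique {n : ℕ}
    {f : EuclideanSpace ℝ (Fin n) → EuclideanSpace ℝ (Fin n)}
    {U : Set (EuclideanSpace ℝ (Fin n))} {y : EuclideanSpace ℝ (Fin n)} {d e : ℤ}
    (hd : HasBrouwerDegree f U y d) (he : HasBrouwerDegree f U y e) : d = e := by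
  obtain ⟨g, hg⟩ := hd.exists_approx
  rw [← hd.eq_signedCount g hg, ← he.eq_signedCount g hg]

/-- `x₀` is a stable solution of `Z x = y`: it is a solution, and every continuous map `W` that is
uniformly `ε`-close to `Z` on the whole space has a solution of `W x = y` which is as close to `x₀`
as we like provided that `ε` is small enough. -/
def IsStableSolution {n : ℕ}
    (Z : EuclideanSpace ℝ (Fin n) → EuclideanSpace ℝ (Fin n))
    (y x₀ : EuclideanSpace ℝ (Fin n)) : Prop :=
  Z x₀ = y ∧
    ∀ δ > 0, ∃ ε > 0, ∀ W : EuclideanSpace ℝ (Fin n) → EuclideanSpace ℝ (Fin n),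
      Continuous W → (∀ x, ‖W x - Z x‖ ≤ ε) → ∃ x, W x = y ∧ ‖x - x₀‖ < δ

/-- The polynomial function on the Euclidean plane attached to a polynomial in two variables. -/
def polyFun (P : MvPolynomial (Fin 2) ℝ) : EuclideanSpace ℝ (Fin 2) → ℝ :=
  fun ξ => MvPolynomial.eval (fun i => ξ i) P

/-- The gradient map `∇P : ℝ² → ℝ²`. -/
def gradMap (P : MvPolynomial (Fin 2) ℝ) : EuclideanSpace ℝ (Fin 2) → EuclideanSpace ℝ (Fin 2) :=
  gradient (polyFun P)

/-- `P` is homogeneous of degree `N + 1` and the origin is its only critical point. -/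
structure IsAdmissiblePoly (N : ℕ) (P : MvPolynomial (Fin 2) ℝ) : Prop where
  homogeneous : P.IsHomogeneous (N + 1)
  critical_iff : ∀ ξ : EuclideanSpace ℝ (Fin 2), gradMap P ξ = 0 ↔ ξ = 0

/-- The nodal lines of `P`: the lines through the origin on which `P` vanishes. -/
def nodalLines (P : MvPolynomial (Fin 2) ℝ) : Set (Submodule ℝ (EuclideanSpace ℝ (Fin 2))) :=
  {L | Module.finrank ℝ L = 1 ∧ ∀ ξ ∈ L, polyFun P ξ = 0}

end

/-! The degree is computed by an integral. For a bump `radialBump ε` supported near 0, integrate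
`radialBump ε (g x) * det Dg x` over `U`. If 0 is a regular value missed on the boundary, then for
small `ε` this is the signed number of zeros times the mass of the bump
(`eventually_degreeIntegral_eq_signedCount`). It does not change along an affine homotopy without
zeros on the boundary, because the variation of the integrand is a divergence
(`integral_cutoff_mul_det_eq`, `eventually_degreeIntegral_eq_of_homotopy`). Hence it suffices to
evaluate it for `∇P` itself, even where 0 is not a regular value.

By homogeneity, polar coordinates reduce that integral to one over the unit circle. Let `A` and `B`
be the radial and tangential components of `∇P` there. By Euler's identity `A` is `N + 1` times the
restriction of `P`, and `B` is the angular derivative of that restriction. The density is 1, for the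
turning of the frame, plus the rotation of the curve `(A, B)`. Since `A' = (N + 1) B`, the curve
crosses the axis `A = 0` always clockwise, so each nodal direction in a half-circle costs exactly
`π`. The total is `2π (1 - M)` (`integral_rotation_eq`,
`IsAdmissiblePoly.integral_det_div_norm_sq`).

At a regular value the signs add up to `1 - M`, so there are at least `|1 - M|` solutions. Each is
nondegenerate, hence stable, by the same degree integral on a small ball. Sard's theorem makes
almost every value regular. For `N = 2`, either the Hessian determinant has no zero off the origin,
and every nonzero value is regular, or `P` is a combination of two cubes of linear forms, in which
case `M = 1` and the bound is 0. -/

open Filter Topology Set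

/-! ### The degree integral and its value at a regular value -/

/-- A smooth radial bump, positive exactly on the ball of radius `ε`. -/
noncomputable def radialBump {n : ℕ} (ε : ℝ) (v : EuclideanSpace ℝ (Fin n)) : ℝ :=
  Real.smoothTransition (1 - ‖v‖ ^ 2 / ε ^ 2)

/-- The integral of the pull-back under `g` of the form `radialBump ε v dv` over `U`. -/
noncomputable def degreeIntegral {n : ℕ}
    (g : EuclideanSpace ℝ (Fin n) → EuclideanSpace ℝ (Fin n))
    (U : Set (EuclideanSpace ℝ (Fin n))) (ε : ℝ) : ℝ :=
  ∫ x in U, radialBump ε (g x) * (fderiv ℝ g x).det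

section LocalDegree

variable {n : ℕ}

theorem contDiff_radialBump (ε : ℝ) :
    ContDiff ℝ ∞ (radialBump ε : EuclideanSpace ℝ (Fin n) → ℝ) := by
  unfold radialBump
  exact Real.smoothTransition.contDiff.comp
    (contDiff_const.sub ((contDiff_norm_sq ℝ).div_const _))

theorem continuous_radialBump (ε : ℝ) :
    Continuous (radialBump ε : EuclideanSpace ℝ (Fin n) → ℝ) :=
  (contDiff_radialBump ε).continuous

theorem radialBump_nonneg (ε : ℝ) (v : EuclideanSpace ℝ (Fin n)) : 0 ≤ radialBump ε v :=
  Real.smoothTransition.nonneg _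

theorem radialBump_eq_zero {ε : ℝ} (hε : 0 < ε) {v : EuclideanSpace ℝ (Fin n)} (hv : ε ≤ ‖v‖) :
    radialBump ε v = 0 := by
  apply Real.smoothTransition.zero_of_nonpos
  have : 1 ≤ ‖v‖ ^ 2 / ε ^ 2 := by
    rw [one_le_div (by positivity)]
    gcongr
  linarith

theorem norm_lt_of_radialBump_ne_zero {ε : ℝ} (hε : 0 < ε) {v : EuclideanSpace ℝ (Fin n)}
    (hv : radialBump ε v ≠ 0) : ‖v‖ < ε := by
  by_contra! h
  exact hv (radialBump_eq_zero hε h)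

theorem hasCompactSupport_radialBump {ε : ℝ} (hε : 0 < ε) :
    HasCompactSupport (radialBump ε : EuclideanSpace ℝ (Fin n) → ℝ) := by
  refine HasCompactSupport.of_support_subset_isCompact (isCompact_closedBall 0 ε) fun v hv => ?_
  simpa using (norm_lt_of_radialBump_ne_zero hε hv).le

theorem integral_radialBump_pos {ε : ℝ} (hε : 0 < ε) :
    0 < ∫ v : EuclideanSpace ℝ (Fin n), radialBump ε v := by
  refine (continuous_radialBump ε).integral_pos_of_hasCompactSupport_nonneg_nonzero
    (hasCompactSupport_radialBump hε) (radialBump_nonneg ε) (x := 0) ?_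
  simp [radialBump]

theorem continuous_det_fderiv {g : EuclideanSpace ℝ (Fin n) → EuclideanSpace ℝ (Fin n)}
    (hg : ContDiff ℝ ∞ g) : Continuous fun x => (fderiv ℝ g x).det :=
  ContinuousLinearMap.continuous_det.comp (hg.continuous_fderiv (by simp))

/-- Near a point with nonzero Jacobian, a smooth map is an injective open map whose Jacobian has a
constant sign. -/
theorem exists_isOpen_injOn_of_det_ne_zero
    {g : EuclideanSpace ℝ (Fin n) → EuclideanSpace ℝ (Fin n)} (hg : ContDiff ℝ ∞ g)
    {x : EuclideanSpace ℝ (Fin n)} (hx : (fderiv ℝ g x).det ≠ 0) :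
    ∃ V, IsOpen V ∧ x ∈ V ∧ InjOn g V ∧ (∀ W ⊆ V, IsOpen W → IsOpen (g '' W)) ∧
      ∀ z ∈ V, SignType.sign (fderiv ℝ g z).det = SignType.sign (fderiv ℝ g x).det := by
  set L := (fderiv ℝ g x).toContinuousLinearEquivOfDetNeZero hx with hL
  have hs : HasStrictFDerivAt g (L : _ →L[ℝ] _) x :=
    hg.contDiffAt.hasStrictFDerivAt (by simp)
  set e := hs.toOpenPartialHomeomorph g with he
  have hsign : ∀ᶠ z in 𝓝 x, SignType.sign (fderiv ℝ g z).det = SignType.sign (fderiv ℝ g x).det := by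
    have hc := (continuous_det_fderiv hg).continuousAt (x := x)
    rcases hx.lt_or_gt with h | h
    · filter_upwards [hc.eventually_lt_const h] with z hz
      rw [sign_neg hz, sign_neg h]
    · filter_upwards [hc.eventually_const_lt h] with z hz
      rw [sign_pos hz, sign_pos h]
  obtain ⟨T, hT, hTo, hxT⟩ := _root_.eventually_nhds_iff.mp hsign
  refine ⟨e.source ∩ T, e.open_source.inter hTo, ⟨hs.mem_toOpenPartialHomeomorph_source, hxT⟩,
    e.injOn.mono inter_subset_left, fun W hW hWo => ?_, fun z hz => hT z hz.2⟩
  exact e.isOpen_image_of_subset_source hWo (hW.trans inter_subset_left)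

/-- The zeros form a compact set, since none lies on the boundary, and a discrete one, by local
injectivity. -/
theorem finite_zeros_of_regular
    {g : EuclideanSpace ℝ (Fin n) → EuclideanSpace ℝ (Fin n)} (hg : ContDiff ℝ ∞ g)
    {U : Set (EuclideanSpace ℝ (Fin n))} (hb : Bornology.IsBounded U)
    (h0 : ∀ x ∈ frontier U, g x ≠ 0)
    (hreg : ∀ x ∈ U, g x = 0 → (fderiv ℝ g x).det ≠ 0) : {x | x ∈ U ∧ g x = 0}.Finite := by
  have hS : {x | x ∈ U ∧ g x = 0} = closure U ∩ g ⁻¹' {0} := by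
    ext x
    refine ⟨fun h => ⟨subset_closure h.1, h.2⟩, fun h => ⟨?_, h.2⟩⟩
    by_contra hxU
    exact h0 x ⟨h.1, fun hi => hxU (interior_subset hi)⟩ h.2
  have hc : IsCompact {x | x ∈ U ∧ g x = 0} := by
    rw [hS]
    exact hb.isCompact_closure.inter_right (isClosed_singleton.preimage hg.continuous)
  refine hc.finite ?_
  rw [isDiscrete_iff_forall_mem_exists_isOpen]
  rintro x ⟨hxU, hx⟩
  obtain ⟨V, hVo, hxV, hinj, -⟩ := exists_isOpen_injOn_of_det_ne_zero hg (hreg x hxU hx)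
  refine ⟨V, hVo, ?_⟩
  ext z
  simp only [mem_inter_iff, mem_ofPred_eq, mem_singleton_iff]
  constructor
  · rintro ⟨hzV, -, hz⟩
    exact hinj hzV hxV (hz.trans hx.symm)
  · rintro rfl
    exact ⟨hxV, hxU, hx⟩

theorem integrableOn_degreeIntegrand
    {g : EuclideanSpace ℝ (Fin n) → EuclideanSpace ℝ (Fin n)} (hg : ContDiff ℝ ∞ g)
    {U : Set (EuclideanSpace ℝ (Fin n))} (hb : Bornology.IsBounded U) (ε : ℝ) :
    IntegrableOn (fun x => radialBump ε (g x) * (fderiv ℝ g x).det) U := by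
  have : Continuous fun x => radialBump ε (g x) * (fderiv ℝ g x).det :=
    ((continuous_radialBump ε).comp hg.continuous).mul (continuous_det_fderiv hg)
  exact (this.continuousOn.integrableOn_compact hb.isCompact_closure).mono_set subset_closure

theorem exists_pos_le_norm_of_isCompact {X : Type*} [TopologicalSpace X] {F : Type*}
    [NormedAddCommGroup F] {g : X → F}
    {K : Set X} (hK : IsCompact K) (hg : ContinuousOn g K) (h0 : ∀ x ∈ K, g x ≠ 0) :
    ∃ m > 0, ∀ x ∈ K, m ≤ ‖g x‖ := by
  rcases K.eq_empty_or_nonempty with rfl | hne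
  · exact ⟨1, one_pos, by simp⟩
  · obtain ⟨x, hx, hmin⟩ := hK.exists_isMinOn hne hg.norm
    exact ⟨‖g x‖, norm_pos_iff.mpr (h0 x hx), fun z hz => hmin hz⟩

/-- Without zeros in the closure of `U`, the degree integral vanishes. -/
theorem eventually_degreeIntegral_eq_zero
    {g : EuclideanSpace ℝ (Fin n) → EuclideanSpace ℝ (Fin n)} (hg : Continuous g)
    {U : Set (EuclideanSpace ℝ (Fin n))} (hb : Bornology.IsBounded U)
    (h0 : ∀ x ∈ closure U, g x ≠ 0) :
    ∀ᶠ ε in 𝓝[>] (0 : ℝ), degreeIntegral g U ε = 0 := by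
  obtain ⟨m, hm, hgm⟩ := exists_pos_le_norm_of_isCompact hb.isCompact_closure hg.continuousOn h0
  filter_upwards [Ioc_mem_nhdsGT hm] with ε hε
  refine setIntegral_eq_zero_of_forall_eq_zero fun x hx => ?_
  rw [radialBump_eq_zero hε.1 (hε.2.trans (hgm x (subset_closure hx))), zero_mul]

/-- At a regular value, the degree integral counts the zeros with their signs. -/
theorem eventually_degreeIntegral_eq_signedCount
    {g : EuclideanSpace ℝ (Fin n) → EuclideanSpace ℝ (Fin n)} (hg : ContDiff ℝ ∞ g)
    {U : Set (EuclideanSpace ℝ (Fin n))} (hU : IsOpen U) (hb : Bornology.IsBounded U)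
    (h0 : ∀ x ∈ frontier U, g x ≠ 0)
    (hreg : ∀ x ∈ U, g x = 0 → (fderiv ℝ g x).det ≠ 0) :
    ∀ᶠ ε in 𝓝[>] (0 : ℝ), degreeIntegral g U ε =
      signedCount g U 0 * ∫ v : EuclideanSpace ℝ (Fin n), radialBump ε v := by
  classical
  have hfin := finite_zeros_of_regular hg hb h0 hreg
  set S := {x | x ∈ U ∧ g x = 0} with hS
  have hloc : ∀ x : EuclideanSpace ℝ (Fin n), ∃ V, x ∈ S → IsOpen V ∧ x ∈ V ∧ InjOn g V ∧
      (∀ W ⊆ V, IsOpen W → IsOpen (g '' W)) ∧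
      ∀ z ∈ V, SignType.sign (fderiv ℝ g z).det = SignType.sign (fderiv ℝ g x).det := by
    intro x
    by_cases hx : x ∈ S
    · obtain ⟨V, hV⟩ := exists_isOpen_injOn_of_det_ne_zero hg (hreg x hx.1 hx.2)
      exact ⟨V, fun _ => hV⟩
    · exact ⟨∅, fun h => absurd h hx⟩
  choose V hV using hloc
  obtain ⟨T, hT, hdisj⟩ := hfin.t2_separation
  set W := fun x => U ∩ V x ∩ T x with hW
  have hWo : ∀ x ∈ S, IsOpen (W x) := fun x hx => (hU.inter (hV x hx).1).inter (hT x).2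
  have hWV : ∀ x, W x ⊆ V x := fun x z hz => hz.1.2
  have hWU : ∀ x, W x ⊆ U := fun x z hz => hz.1.1
  have hxW : ∀ x ∈ S, x ∈ W x := fun x hx => ⟨⟨hx.1, (hV x hx).2.1⟩, (hT x).1⟩
  have himo : ∀ x ∈ S, IsOpen (g '' W x) :=
    fun x hx => (hV x hx).2.2.2.1 _ (hWV x) (hWo x hx)
  have him : ∀ x ∈ S, g '' W x ∈ 𝓝 0 := fun x hx =>
    (himo x hx).mem_nhds ⟨x, hxW x hx, hx.2⟩
  obtain ⟨ρ, hρ, hball⟩ : ∃ ρ > 0, ball 0 ρ ⊆ ⋂ x ∈ S, g '' W x :=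
    Metric.mem_nhds_iff.mp ((biInter_mem hfin).mpr him)
  have hK : IsCompact (closure U \ ⋃ x ∈ S, W x) :=
    hb.isCompact_closure.diff (isOpen_biUnion hWo)
  obtain ⟨m, hm, hgm⟩ := exists_pos_le_norm_of_isCompact hK hg.continuous.continuousOn (by
    rintro x ⟨hxc, hx⟩ hgx
    by_cases hxU : x ∈ U
    · exact hx (mem_biUnion (show x ∈ S from ⟨hxU, hgx⟩) (hxW x ⟨hxU, hgx⟩))
    · exact h0 x ⟨hxc, fun hi => hxU (interior_subset hi)⟩ hgx)
  -- `ε ≤ ρ` puts the support of the bump inside every image `g '' W x`, so each piece sees its full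
  -- mass. `ε ≤ m` makes the integrand vanish on `U` off the pieces.
  filter_upwards [Ioc_mem_nhdsGT (lt_min hρ hm)] with ε ⟨hε, hεle⟩
  have hερ := hεle.trans (min_le_left _ _)
  have hεm := hεle.trans (min_le_right _ _)
  have hint := integrableOn_degreeIntegrand hg hb ε
  have hpiece : ∀ x ∈ S, ∫ z in W x, radialBump ε (g z) * (fderiv ℝ g z).det =
      (((SignType.sign (fderiv ℝ g x).det : SignType) : ℤ) : ℝ) *
        ∫ v : EuclideanSpace ℝ (Fin n), radialBump ε v := by
    intro x hx
    have hcov := integral_image_eq_integral_abs_det_fderiv_smul volume (hWo x hx).measurableSet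
      (fun z _ => (hg.differentiable (by simp) z).hasFDerivAt.hasFDerivWithinAt)
      ((hV x hx).2.2.1.mono (hWV x)) (radialBump ε)
    have hfull : ∫ v in g '' W x, radialBump ε v =
        ∫ v : EuclideanSpace ℝ (Fin n), radialBump ε v := by
      refine setIntegral_eq_integral_of_forall_compl_eq_zero fun v hv => ?_
      refine radialBump_eq_zero hε ?_
      by_contra! hlt
      have hvb : v ∈ ball (0 : EuclideanSpace ℝ (Fin n)) ρ := by
        simpa using hlt.trans_le hερ
      exact hv (mem_iInter₂.mp (hball hvb) x hx)
    rw [← hfull, hcov, ← integral_const_mul]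
    refine setIntegral_congr_fun (hWo x hx).measurableSet fun z hz => ?_
    simp only [smul_eq_mul]
    rw [← (hV x hx).2.2.2.2 z (hWV x hz)]
    rcases lt_trichotomy (fderiv ℝ g z).det 0 with h | h | h
    · simp [sign_neg h, abs_of_neg h, mul_comm]
    · simp [h]
    · simp [sign_pos h, abs_of_pos h, mul_comm]
  have hsum : degreeIntegral g U ε =
      ∑ x ∈ hfin.toFinset, ∫ z in W x, radialBump ε (g z) * (fderiv ℝ g z).det := by
    rw [← integral_biUnion_finset]
    · refine setIntegral_eq_of_subset_of_forall_sdiff_eq_zero hU.measurableSet ?_ ?_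
      · exact iUnion₂_subset fun x _ => hWU x
      · rintro z ⟨hzU, hz⟩
        have : ε ≤ ‖g z‖ := hεm.trans (hgm z ⟨subset_closure hzU, by simpa using hz⟩)
        rw [radialBump_eq_zero hε this, zero_mul]
    · intro x hx
      exact (hWo x (hfin.mem_toFinset.mp hx)).measurableSet
    · intro x hx z hz hxz
      exact (hdisj (hfin.mem_toFinset.mp hx) (hfin.mem_toFinset.mp hz) hxz).mono
        inter_subset_right inter_subset_right
    · exact fun x _ => hint.mono_set (hWU x)
  rw [hsum, Finset.sum_congr rfl fun x hx => hpiece x (hfin.mem_toFinset.mp hx),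
    ← Finset.sum_mul, signedCount, finsum_mem_eq_finite_toFinset_sum _ hfin]
  push_cast
  rfl

end LocalDegree

/-! ### Homotopy invariance of the degree integral in the plane -/

section PlaneHomotopy

/-- The `i`-th partial derivative of a function on the Euclidean plane. -/
noncomputable def partialDeriv (i : Fin 2) (f : EuclideanSpace ℝ (Fin 2) → ℝ)
    (x : EuclideanSpace ℝ (Fin 2)) : ℝ :=
  fderiv ℝ f x (EuclideanSpace.single i 1)

theorem ContDiff.partialDeriv {f : EuclideanSpace ℝ (Fin 2) → ℝ} (hf : ContDiff ℝ ∞ f)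
    (i : Fin 2) : ContDiff ℝ ∞ (partialDeriv i f) :=
  (hf.fderiv_right (m := ∞) (by simp)).clm_apply contDiff_const

theorem partialDeriv_comm {f : EuclideanSpace ℝ (Fin 2) → ℝ} (hf : ContDiff ℝ ∞ f)
    (i j : Fin 2) (x : EuclideanSpace ℝ (Fin 2)) :
    partialDeriv i (partialDeriv j f) x = partialDeriv j (partialDeriv i f) x := by
  have hd : DifferentiableAt ℝ (fderiv ℝ f) x :=
    (hf.fderiv_right (m := ∞) (by simp)).differentiable (by simp) x
  have key : ∀ k l : Fin 2, partialDeriv k (partialDeriv l f) x =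
      fderiv ℝ (fderiv ℝ f) x (EuclideanSpace.single k 1) (EuclideanSpace.single l 1) := by
    intro k l
    have : HasFDerivAt (partialDeriv l f) _ x := hd.hasFDerivAt.clm_apply (hasFDerivAt_const _ x)
    rw [partialDeriv, this.fderiv]
    simp
  rw [key, key]
  exact (hf.contDiffAt.isSymmSndFDerivAt (by
    simp only [minSmoothness_of_isRCLikeNormedField]
    exact WithTop.coe_le_coe.mpr (le_top : (2 : ℕ∞) ≤ ⊤))) _ _

theorem partialDeriv_mul {f g : EuclideanSpace ℝ (Fin 2) → ℝ} (hf : ContDiff ℝ ∞ f)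
    (hg : ContDiff ℝ ∞ g) (i : Fin 2) (x : EuclideanSpace ℝ (Fin 2)) :
    partialDeriv i (fun y => f y * g y) x =
      partialDeriv i f x * g x + f x * partialDeriv i g x := by
  have := ((hf.differentiable (by simp) x).hasFDerivAt.mul
    (hg.differentiable (by simp) x).hasFDerivAt).fderiv
  simp only [partialDeriv]
  rw [show (fun y => f y * g y) = f * g from rfl, this]
  simp
  ring

theorem partialDeriv_sub {f g : EuclideanSpace ℝ (Fin 2) → ℝ} (hf : ContDiff ℝ ∞ f)
    (hg : ContDiff ℝ ∞ g) (i : Fin 2) (x : EuclideanSpace ℝ (Fin 2)) :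
    partialDeriv i (fun y => f y - g y) x = partialDeriv i f x - partialDeriv i g x := by
  have := ((hf.differentiable (by simp) x).hasFDerivAt.sub
    (hg.differentiable (by simp) x).hasFDerivAt).fderiv
  simp only [partialDeriv]
  rw [show (fun y => f y - g y) = f - g from rfl, this]
  simp

theorem partialDeriv_add_mul {f g : EuclideanSpace ℝ (Fin 2) → ℝ} (hf : ContDiff ℝ ∞ f)
    (hg : ContDiff ℝ ∞ g) (t : ℝ) (i : Fin 2) (x : EuclideanSpace ℝ (Fin 2)) :
    partialDeriv i (fun y => f y + t * g y) x = partialDeriv i f x + t * partialDeriv i g x := by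
  have := ((hf.differentiable (by simp) x).hasFDerivAt.add
    ((hg.differentiable (by simp) x).hasFDerivAt.const_mul t)).fderiv
  simp only [partialDeriv]
  rw [show (fun y => f y + t * g y) = f + fun y => t * g y from rfl, this]
  simp

theorem continuousLinearMap_apply_eq (L : EuclideanSpace ℝ (Fin 2) →L[ℝ] ℝ)
    (v : EuclideanSpace ℝ (Fin 2)) :
    L v = v 0 * L (EuclideanSpace.single 0 1) + v 1 * L (EuclideanSpace.single 1 1) := by
  have hv : v = v 0 • EuclideanSpace.single 0 (1 : ℝ) + v 1 • EuclideanSpace.single 1 (1 : ℝ) := by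
    ext i
    fin_cases i <;> simp
  conv_lhs => rw [hv]
  simp

theorem det_eq_of_plane (L : EuclideanSpace ℝ (Fin 2) →L[ℝ] EuclideanSpace ℝ (Fin 2)) :
    L.det = L (EuclideanSpace.single 0 1) 0 * L (EuclideanSpace.single 1 1) 1 -
      L (EuclideanSpace.single 1 1) 0 * L (EuclideanSpace.single 0 1) 1 := by
  rw [ContinuousLinearMap.det, ← LinearMap.det_toMatrix (EuclideanSpace.basisFun (Fin 2) ℝ).toBasis,
    Matrix.det_fin_two]
  simp [LinearMap.toMatrix_apply]

theorem contDiff_coord {g : EuclideanSpace ℝ (Fin 2) → EuclideanSpace ℝ (Fin 2)}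
    (hg : ContDiff ℝ ∞ g) (i : Fin 2) : ContDiff ℝ ∞ fun x => g x i :=
  contDiff_euclidean.mp hg i

theorem fderiv_apply_coord {g : EuclideanSpace ℝ (Fin 2) → EuclideanSpace ℝ (Fin 2)}
    (hg : ContDiff ℝ ∞ g) (x : EuclideanSpace ℝ (Fin 2)) (i j : Fin 2) :
    fderiv ℝ g x (EuclideanSpace.single i 1) j = partialDeriv i (fun y => g y j) x := by
  have h := ((EuclideanSpace.proj (𝕜 := ℝ) j).hasFDerivAt.comp x
    (hg.differentiable (by simp) x).hasFDerivAt).fderiv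
  rw [partialDeriv, show (fun y => g y j) = EuclideanSpace.proj (𝕜 := ℝ) j ∘ g from rfl, h]
  rfl

theorem det_fderiv_eq {g : EuclideanSpace ℝ (Fin 2) → EuclideanSpace ℝ (Fin 2)}
    (hg : ContDiff ℝ ∞ g) (x : EuclideanSpace ℝ (Fin 2)) :
    (fderiv ℝ g x).det =
      partialDeriv 0 (fun y => g y 0) x * partialDeriv 1 (fun y => g y 1) x -
        partialDeriv 1 (fun y => g y 0) x * partialDeriv 0 (fun y => g y 1) x := by
  rw [det_eq_of_plane]
  simp only [fderiv_apply_coord hg]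

theorem integral_partialDeriv_eq_zero {f : EuclideanSpace ℝ (Fin 2) → ℝ} (hf : ContDiff ℝ ∞ f)
    (hc : HasCompactSupport f) (i : Fin 2) : ∫ x, partialDeriv i f x = 0 := by
  have hd : HasCompactSupport (partialDeriv i f) := hc.fderiv_apply ℝ _
  have := integral_mul_fderiv_eq_neg_fderiv_mul_of_integrable (μ := volume)
    (f := fun _ : EuclideanSpace ℝ (Fin 2) => (1 : ℝ)) (g := f)
    (v := EuclideanSpace.single i (1 : ℝ)) (by simp)
    (by simp only [one_mul]
        exact (hf.partialDeriv i).continuous.integrable_of_hasCompactSupport hd)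
    (by simpa using hf.continuous.integrable_of_hasCompactSupport hc)
    (fun _ _ => differentiableAt_const _) (fun x _ => hf.differentiable (by simp) x)
  simpa [partialDeriv] using this

/-- The variation of `χ ψ da ∧ db` in the direction `(p, q)` is exact. -/
theorem partialDeriv_add_partialDeriv_eq {a b p q χ ψ : EuclideanSpace ℝ (Fin 2) → ℝ}
    (ha : ContDiff ℝ ∞ a) (hb : ContDiff ℝ ∞ b) (hp : ContDiff ℝ ∞ p) (hq : ContDiff ℝ ∞ q)
    (hχ : ContDiff ℝ ∞ χ) (hψ : ContDiff ℝ ∞ ψ) {x : EuclideanSpace ℝ (Fin 2)} {α β : ℝ}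
    (hψd : ∀ i, partialDeriv i ψ x = α * partialDeriv i a x + β * partialDeriv i b x)
    (hχd : ∀ i, ψ x * partialDeriv i χ x = 0) :
    partialDeriv 0 (fun y => (χ y * ψ y) *
        (p y * partialDeriv 1 b y - q y * partialDeriv 1 a y)) x +
      partialDeriv 1 (fun y => (χ y * ψ y) *
        (q y * partialDeriv 0 a y - p y * partialDeriv 0 b y)) x =
    χ x * ((α * p x + β * q x) *
        (partialDeriv 0 a x * partialDeriv 1 b x - partialDeriv 1 a x * partialDeriv 0 b x) +
      ψ x * (partialDeriv 0 p x * partialDeriv 1 b x + partialDeriv 0 a x * partialDeriv 1 q x -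
        partialDeriv 1 p x * partialDeriv 0 b x - partialDeriv 1 a x * partialDeriv 0 q x)) := by
  have ha' := ha.partialDeriv
  have hb' := hb.partialDeriv
  rw [partialDeriv_mul (hχ.mul hψ) ((hp.mul (hb' 1)).sub (hq.mul (ha' 1))),
    partialDeriv_mul (hχ.mul hψ) ((hq.mul (ha' 0)).sub (hp.mul (hb' 0))),
    partialDeriv_sub (hp.mul (hb' 1)) (hq.mul (ha' 1)),
    partialDeriv_sub (hq.mul (ha' 0)) (hp.mul (hb' 0)),
    partialDeriv_mul hχ hψ, partialDeriv_mul hχ hψ,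
    partialDeriv_mul hp (hb' 1), partialDeriv_mul hq (ha' 1),
    partialDeriv_mul hq (ha' 0), partialDeriv_mul hp (hb' 0),
    partialDeriv_comm ha 1 0, partialDeriv_comm hb 1 0, hψd, hψd]
  -- After the product rule and the symmetry of second derivatives, only the terms in which the
  -- derivative falls on `χ` remain. They carry a factor `ψ`, so `hχd` removes them.
  linear_combination (p x * partialDeriv 1 b x - q x * partialDeriv 1 a x) * hχd 0 +
    (q x * partialDeriv 0 a x - p x * partialDeriv 0 b x) * hχd 1

theorem partialDeriv_comp {φ : EuclideanSpace ℝ (Fin 2) → ℝ}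
    {g : EuclideanSpace ℝ (Fin 2) → EuclideanSpace ℝ (Fin 2)} (hφ : ContDiff ℝ ∞ φ)
    (hg : ContDiff ℝ ∞ g) (i : Fin 2) (x : EuclideanSpace ℝ (Fin 2)) :
    partialDeriv i (fun y => φ (g y)) x =
      partialDeriv 0 φ (g x) * partialDeriv i (fun y => g y 0) x +
        partialDeriv 1 φ (g x) * partialDeriv i (fun y => g y 1) x := by
  have := ((hφ.differentiable (by simp) (g x)).hasFDerivAt.comp x
    (hg.differentiable (by simp) x).hasFDerivAt).fderiv
  rw [partialDeriv, show (fun y => φ (g y)) = φ ∘ g from rfl, this,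
    ContinuousLinearMap.comp_apply, continuousLinearMap_apply_eq, fderiv_apply_coord hg,
    fderiv_apply_coord hg]
  simp only [partialDeriv]
  ring

/-- The integral of `χ φ(h) det Dh` is constant along an affine homotopy `h = g + t w`, provided the
cut-off `χ` is locally constant where `φ(h)` does not vanish. -/
theorem integral_cutoff_mul_det_eq {g w : EuclideanSpace ℝ (Fin 2) → EuclideanSpace ℝ (Fin 2)}
    {χ φ : EuclideanSpace ℝ (Fin 2) → ℝ} (hg : ContDiff ℝ ∞ g) (hw : ContDiff ℝ ∞ w)
    (hχ : ContDiff ℝ ∞ χ) (hχc : HasCompactSupport χ) (hφ : ContDiff ℝ ∞ φ)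
    (hcut : ∀ t ∈ Icc (0 : ℝ) 1, ∀ x, φ (g x + t • w x) ≠ 0 → fderiv ℝ χ x = 0) :
    ∫ x, χ x * (φ (g x + w x) * (fderiv ℝ (fun y => g y + w y) x).det) =
      ∫ x, χ x * (φ (g x) * (fderiv ℝ g x).det) := by
  set a := fun x => g x 0 with ha_def
  set b := fun x => g x 1 with hb_def
  set p := fun x => w x 0 with hp_def
  set q := fun x => w x 1 with hq_def
  have ha : ContDiff ℝ ∞ a := contDiff_coord hg 0
  have hb : ContDiff ℝ ∞ b := contDiff_coord hg 1
  have hp : ContDiff ℝ ∞ p := contDiff_coord hw 0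
  have hq : ContDiff ℝ ∞ q := contDiff_coord hw 1
  have hh : ∀ t : ℝ, ContDiff ℝ ∞ fun y => g y + t • w y := fun t => hg.add (hw.const_smul t)
  set J : ℝ → EuclideanSpace ℝ (Fin 2) → ℝ := fun t x =>
    (partialDeriv 0 a x + t * partialDeriv 0 p x) * (partialDeriv 1 b x + t * partialDeriv 1 q x) -
      (partialDeriv 1 a x + t * partialDeriv 1 p x) * (partialDeriv 0 b x + t * partialDeriv 0 q x)
    with hJ
  have hdet : ∀ t x, (fderiv ℝ (fun y => g y + t • w y) x).det = J t x := by
    intro t x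
    rw [det_fderiv_eq (hh t)]
    simp only [PiLp.add_apply, PiLp.smul_apply, smul_eq_mul]
    rw [partialDeriv_add_mul ha hp, partialDeriv_add_mul ha hp, partialDeriv_add_mul hb hq,
      partialDeriv_add_mul hb hq]
  set J' : ℝ → EuclideanSpace ℝ (Fin 2) → ℝ := fun t x =>
    partialDeriv 0 p x * (partialDeriv 1 b x + t * partialDeriv 1 q x) +
      (partialDeriv 0 a x + t * partialDeriv 0 p x) * partialDeriv 1 q x -
      partialDeriv 1 p x * (partialDeriv 0 b x + t * partialDeriv 0 q x) -
      (partialDeriv 1 a x + t * partialDeriv 1 p x) * partialDeriv 0 q x with hJ'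
  set K' : ℝ → EuclideanSpace ℝ (Fin 2) → ℝ := fun t x =>
    χ x * ((partialDeriv 0 φ (g x + t • w x) * p x + partialDeriv 1 φ (g x + t • w x) * q x) *
      J t x + φ (g x + t • w x) * J' t x) with hK'
  have hderiv : ∀ t x, HasDerivAt (fun s => χ x * (φ (g x + s • w x) * J s x)) (K' t x) t := by
    intro t x
    have h1 : HasDerivAt (fun s : ℝ => g x + s • w x) (w x) t := by
      simpa using ((hasDerivAt_id t).smul_const (w x)).const_add (g x)
    have h2 : HasDerivAt (fun s : ℝ => φ (g x + s • w x))
        (partialDeriv 0 φ (g x + t • w x) * p x + partialDeriv 1 φ (g x + t • w x) * q x) t := by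
      have := (hφ.differentiable (by simp) (g x + t • w x)).hasFDerivAt.comp_hasDerivAt t h1
      rw [continuousLinearMap_apply_eq] at this
      refine this.congr_deriv ?_
      simp only [partialDeriv, p, q]
      ring
    have lin : ∀ c d : ℝ, HasDerivAt (fun s : ℝ => c + s * d) d t := fun c d => by
      simpa using ((hasDerivAt_id t).mul_const d).const_add c
    have h3 : HasDerivAt (fun s : ℝ => J s x) (J' t x) t := by
      have := ((lin (partialDeriv 0 a x) (partialDeriv 0 p x)).mul
        (lin (partialDeriv 1 b x) (partialDeriv 1 q x))).sub
        ((lin (partialDeriv 1 a x) (partialDeriv 1 p x)).mul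
        (lin (partialDeriv 0 b x) (partialDeriv 0 q x)))
      refine this.congr_deriv ?_
      simp only [J']
      ring
    exact (h2.mul h3).const_mul (χ x)
  have hcont : Continuous (Function.uncurry K') := by
    have c0 := fun i => (ha.partialDeriv i).continuous
    have c1 := fun i => (hb.partialDeriv i).continuous
    have c2 := fun i => (hp.partialDeriv i).continuous
    have c3 := fun i => (hq.partialDeriv i).continuous
    have c4 := fun i => (hφ.partialDeriv i).continuous
    have c5 := hχ.continuous
    have c6 := hφ.continuous
    have c7 := hg.continuous
    have c8 := hw.continuous
    have c9 := hp.continuous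
    have c10 := hq.continuous
    simp only [hK', hJ, hJ', Function.uncurry_def]
    fun_prop
  -- For fixed `t` the variation is the divergence of a compactly supported field.
  have hspace : ∀ t ∈ Icc (0 : ℝ) 1, ∫ x, K' t x = 0 := by
    intro t ht
    set A := fun x => a x + t * p x with hA
    set B := fun x => b x + t * q x with hB
    have hAs : ContDiff ℝ ∞ A := ha.add (contDiff_const.mul hp)
    have hBs : ContDiff ℝ ∞ B := hb.add (contDiff_const.mul hq)
    have hψs : ContDiff ℝ ∞ fun y => φ (g y + t • w y) := hφ.comp (hh t)
    have hAd : ∀ i x, partialDeriv i A x = partialDeriv i a x + t * partialDeriv i p x :=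
      fun i x => partialDeriv_add_mul ha hp t i x
    have hBd : ∀ i x, partialDeriv i B x = partialDeriv i b x + t * partialDeriv i q x :=
      fun i x => partialDeriv_add_mul hb hq t i x
    have hKeq : ∀ x, K' t x = partialDeriv 0 (fun y => (χ y * φ (g y + t • w y)) *
          (p y * partialDeriv 1 B y - q y * partialDeriv 1 A y)) x +
        partialDeriv 1 (fun y => (χ y * φ (g y + t • w y)) *
          (q y * partialDeriv 0 A y - p y * partialDeriv 0 B y)) x := by
      intro x
      rw [partialDeriv_add_partialDeriv_eq hAs hBs hp hq hχ hψs
        (α := partialDeriv 0 φ (g x + t • w x)) (β := partialDeriv 1 φ (g x + t • w x))]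
      · simp only [hK', hJ, hJ', hAd, hBd]
      · intro i
        exact partialDeriv_comp hφ (hh t) i x
      · intro i
        by_cases h : φ (g x + t • w x) = 0
        · simp [h]
        · simp [partialDeriv, hcut t ht x h]
    have hs0 : ContDiff ℝ ∞ fun y => (χ y * φ (g y + t • w y)) *
          (p y * partialDeriv 1 B y - q y * partialDeriv 1 A y) :=
      (hχ.mul hψs).mul ((hp.mul (hBs.partialDeriv 1)).sub (hq.mul (hAs.partialDeriv 1)))
    have hs1 : ContDiff ℝ ∞ fun y => (χ y * φ (g y + t • w y)) *
          (q y * partialDeriv 0 A y - p y * partialDeriv 0 B y) :=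
      (hχ.mul hψs).mul ((hq.mul (hAs.partialDeriv 0)).sub (hp.mul (hBs.partialDeriv 0)))
    have hc0 : HasCompactSupport fun y => (χ y * φ (g y + t • w y)) *
        (p y * partialDeriv 1 B y - q y * partialDeriv 1 A y) := (hχc.mul_right).mul_right
    have hc1 : HasCompactSupport fun y => (χ y * φ (g y + t • w y)) *
        (q y * partialDeriv 0 A y - p y * partialDeriv 0 B y) := (hχc.mul_right).mul_right
    simp_rw [hKeq]
    rw [integral_add, integral_partialDeriv_eq_zero hs0 hc0, integral_partialDeriv_eq_zero hs1 hc1,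
      add_zero]
    · exact (hs0.partialDeriv 0).continuous.integrable_of_hasCompactSupport (hc0.fderiv_apply ℝ _)
    · exact (hs1.partialDeriv 1).continuous.integrable_of_hasCompactSupport (hc1.fderiv_apply ℝ _)
  have hint : Integrable (Function.uncurry K')
      ((volume.restrict (uIoc (0 : ℝ) 1)).prod (volume : Measure (EuclideanSpace ℝ (Fin 2)))) := by
    have h1 : IntegrableOn (Function.uncurry K') (Icc (0 : ℝ) 1 ×ˢ tsupport χ)
        (volume.prod volume) :=
      hcont.continuousOn.integrableOn_compact (isCompact_Icc.prod hχc)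
    have h2 : IntegrableOn (Function.uncurry K') (uIoc (0 : ℝ) 1 ×ˢ univ)
        (volume.prod volume) := by
      refine (h1.mono_set (prod_mono_left (uIoc_of_le (zero_le_one' ℝ) ▸ Ioc_subset_Icc_self))
        ).of_forall_sdiff_eq_zero (measurableSet_uIoc.prod MeasurableSet.univ) ?_
      rintro ⟨t, x⟩ ⟨⟨ht, -⟩, hx⟩
      have : χ x = 0 := image_eq_zero_of_notMem_tsupport fun h => hx ⟨ht, h⟩
      simp [hK', this]
    rwa [IntegrableOn, ← Measure.prod_restrict, Measure.restrict_univ] at h2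
  have hFTC : ∀ x, ∫ t in (0 : ℝ)..1, K' t x =
      χ x * (φ (g x + (1 : ℝ) • w x) * J 1 x) - χ x * (φ (g x + (0 : ℝ) • w x) * J 0 x) := by
    intro x
    refine intervalIntegral.integral_eq_sub_of_hasDerivAt (fun t _ => hderiv t x) ?_
    exact (hcont.comp (Continuous.prodMk continuous_id continuous_const)).intervalIntegrable _ _
  -- In place of differentiation under the integral sign: integrate `K'` over `[0, 1]` times the
  -- plane in both orders. One order gives 0 by `hspace`, the other the difference of the two end
  -- values by `hFTC`.
  have hswap := intervalIntegral_integral_swap hint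
  rw [intervalIntegral.integral_congr (g := fun _ => 0) (fun t ht => hspace t
    (by rwa [uIcc_of_le zero_le_one] at ht))] at hswap
  simp only [intervalIntegral.integral_zero, hFTC] at hswap
  have hKint : ∀ t, Integrable fun x => χ x * (φ (g x + t • w x) * J t x) := by
    intro t
    simp_rw [← hdet t]
    refine Continuous.integrable_of_hasCompactSupport ?_ hχc.mul_right
    exact hχ.continuous.mul ((hφ.continuous.comp (hh t).continuous).mul
      (continuous_det_fderiv (hh t)))
  rw [integral_sub (hKint 1) (hKint 0)] at hswap
  have e1 := sub_eq_zero.mp hswap.symm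
  simp only [← hdet] at e1
  simpa using e1

/-- Homotopy invariance of the degree integral, for affine homotopies. -/
theorem eventually_degreeIntegral_eq_of_homotopy
    {g₀ g₁ : EuclideanSpace ℝ (Fin 2) → EuclideanSpace ℝ (Fin 2)} (hg₀ : ContDiff ℝ ∞ g₀)
    (hg₁ : ContDiff ℝ ∞ g₁) {U : Set (EuclideanSpace ℝ (Fin 2))} (hU : IsOpen U)
    (hb : Bornology.IsBounded U)
    (h0 : ∀ x ∈ frontier U, ∀ t ∈ Icc (0 : ℝ) 1, g₀ x + t • (g₁ x - g₀ x) ≠ 0) :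
    ∀ᶠ ε in 𝓝[>] (0 : ℝ), degreeIntegral g₁ U ε = degreeIntegral g₀ U ε := by
  have hh : Continuous fun z : ℝ × EuclideanSpace ℝ (Fin 2) =>
      g₀ z.2 + z.1 • (g₁ z.2 - g₀ z.2) := by
    have := hg₀.continuous
    have := hg₁.continuous
    fun_prop
  have hfr : IsCompact (frontier U) :=
    hb.isCompact_closure.of_isClosed_subset isClosed_frontier frontier_subset_closure
  obtain ⟨m, hm, hgm⟩ := exists_pos_le_norm_of_isCompact
    ((isCompact_Icc (a := (0 : ℝ)) (b := 1)).prod hfr)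
    hh.continuousOn (fun z hz => h0 z.2 hz.2 z.1 hz.1)
  filter_upwards [Ioo_mem_nhdsGT hm] with ε ⟨hε, hεm⟩
  -- `C` collects the points of `closure U` at which some stage of the homotopy has norm at most
  -- `ε`. As `ε < m`, it is a compact subset of `U`, so there is a cut-off `χ` equal to 1 near `C`
  -- and to 0 near the complement of `U`.
  set C := Prod.snd '' ((Icc (0 : ℝ) 1 ×ˢ closure U) ∩
    {z | ‖g₀ z.2 + z.1 • (g₁ z.2 - g₀ z.2)‖ ≤ ε}) with hC
  have hCc : IsCompact C := (((isCompact_Icc (a := (0 : ℝ)) (b := 1)).prod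
    hb.isCompact_closure).inter_right (isClosed_le hh.norm continuous_const)).image continuous_snd
  have hCU : C ⊆ U := by
    rintro _ ⟨⟨t, x⟩, ⟨⟨ht, hx⟩, hle⟩, rfl⟩
    by_contra hxU
    exact absurd (hgm (t, x) ⟨ht, hx, fun hi => hxU (interior_subset hi)⟩)
      (not_le.mpr (lt_of_le_of_lt hle hεm))
  obtain ⟨χ, hχ0, hχ1, -⟩ := exists_contMDiffMap_zero_one_nhds_of_isClosed
    (modelWithCornersSelf ℝ (EuclideanSpace ℝ (Fin 2))) (n := ⊤) hU.isClosed_compl hCc.isClosed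
    (disjoint_left.mpr fun x hx hxC => hx (hCU hxC))
  have hχs : ContDiff ℝ ∞ χ := contMDiff_iff_contDiff.mp χ.contMDiff
  have hχU : ∀ x ∉ U, χ x = 0 := fun x hx => (hχ0.self_of_nhdsSet x hx)
  have hχc : HasCompactSupport χ := by
    refine HasCompactSupport.of_support_subset_isCompact hb.isCompact_closure fun x hx => ?_
    by_contra hxU
    exact hx (hχU x fun h => hxU (subset_closure h))
  have key := integral_cutoff_mul_det_eq hg₀ (hg₁.sub hg₀) hχs hχc (contDiff_radialBump ε) (by
    intro t ht x hne
    have hlt := norm_lt_of_radialBump_ne_zero hε hne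
    by_cases hxU : x ∈ closure U
    · have hxC : x ∈ C := ⟨(t, x), ⟨⟨ht, hxU⟩, hlt.le⟩, rfl⟩
      have hev : χ =ᶠ[𝓝 x] fun _ => 1 := (eventually_nhdsSet_iff_forall.mp hχ1) x hxC
      rw [hev.fderiv_eq, fderiv_const_apply]
    · have hev : χ =ᶠ[𝓝 x] fun _ => 0 :=
        (eventually_nhdsSet_iff_forall.mp hχ0) x fun h => hxU (subset_closure h)
      rw [hev.fderiv_eq, fderiv_const_apply])
  -- Inserting `χ` is harmless: in `U`, it is 1 wherever the bump is nonzero, and outside `U` it is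
  -- 0.
  have hred : ∀ s ∈ Icc (0 : ℝ) 1, ∀ f : EuclideanSpace ℝ (Fin 2) → EuclideanSpace ℝ (Fin 2),
      (∀ x, f x = g₀ x + s • (g₁ x - g₀ x)) → degreeIntegral f U ε =
        ∫ x, χ x * (radialBump ε (f x) * (fderiv ℝ f x).det) := by
    intro s hs f hf
    rw [degreeIntegral, ← setIntegral_eq_integral_of_forall_compl_eq_zero (s := U)
      (f := fun x => χ x * (radialBump ε (f x) * (fderiv ℝ f x).det))
      (fun x hx => by rw [hχU x hx, zero_mul])]
    refine setIntegral_congr_fun hU.measurableSet fun x hx => ?_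
    by_cases hz : radialBump ε (f x) = 0
    · simp [hz]
    · have hlt := norm_lt_of_radialBump_ne_zero hε hz
      have hxC : x ∈ C := ⟨(s, x), ⟨⟨hs, subset_closure hx⟩, by rw [hf] at hlt; exact hlt.le⟩, rfl⟩
      have : χ x = 1 := hχ1.self_of_nhdsSet x hxC
      simp [this]
  rw [hred 1 (by simp) g₁ (by simp), hred 0 (by simp) g₀ (by simp)]
  simpa using key

end PlaneHomotopy

/-! ### Calculus of polynomial functions on the plane, Euler's identity -/

section PlanePolynomial

open MvPolynomial

theorem hasFDerivAt_polyFun (P : MvPolynomial (Fin 2) ℝ) (x : EuclideanSpace ℝ (Fin 2)) :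
    HasFDerivAt (polyFun P)
      (∑ i, polyFun (pderiv i P) x • (EuclideanSpace.proj i : EuclideanSpace ℝ (Fin 2) →L[ℝ] ℝ))
      x := by
  induction P using MvPolynomial.induction_on with
  | C a =>
    have : polyFun (C a) = fun _ => a := by
      funext y
      simp [polyFun]
    rw [this]
    refine (hasFDerivAt_const a x).congr_fderiv ?_
    simp [polyFun]
  | add p q hp hq =>
    have : polyFun (p + q) = polyFun p + polyFun q := by
      funext y
      simp [polyFun]
    rw [this]
    refine (hp.add hq).congr_fderiv ?_
    rw [← Finset.sum_add_distrib]
    refine Finset.sum_congr rfl fun i _ => ?_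
    simp [polyFun, add_smul]
  | mul_X p j hp =>
    have : polyFun (p * X j) =
        polyFun p * (EuclideanSpace.proj j : EuclideanSpace ℝ (Fin 2) →L[ℝ] ℝ) := by
      funext y
      simp [polyFun]
    rw [this]
    refine (hp.mul (EuclideanSpace.proj j).hasFDerivAt).congr_fderiv ?_
    ext v
    simp only [polyFun, Derivation.leibniz, pderiv_X, Fin.sum_univ_two]
    fin_cases j <;> simp <;> ring

theorem contDiff_polyFun (P : MvPolynomial (Fin 2) ℝ) : ContDiff ℝ ∞ (polyFun P) := by
  induction P using MvPolynomial.induction_on with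
  | C a =>
    have : polyFun (C a) = fun _ => a := by
      funext y
      simp [polyFun]
    rw [this]
    exact contDiff_const
  | add p q hp hq =>
    have : polyFun (p + q) = fun y => polyFun p y + polyFun q y := by
      funext y
      simp [polyFun]
    rw [this]
    exact hp.add hq
  | mul_X p j hp =>
    have : polyFun (p * X j) =
        fun y => polyFun p y * (EuclideanSpace.proj j : EuclideanSpace ℝ (Fin 2) →L[ℝ] ℝ) y := by
      funext y
      simp [polyFun]
    rw [this]
    exact hp.mul
      (EuclideanSpace.proj j : EuclideanSpace ℝ (Fin 2) →L[ℝ] ℝ).contDiff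

theorem partialDeriv_polyFun (P : MvPolynomial (Fin 2) ℝ) (i : Fin 2) :
    partialDeriv i (polyFun P) = polyFun (pderiv i P) := by
  funext x
  rw [partialDeriv, (hasFDerivAt_polyFun P x).fderiv]
  fin_cases i <;> simp [Fin.sum_univ_two]

theorem gradMap_apply (P : MvPolynomial (Fin 2) ℝ) (x : EuclideanSpace ℝ (Fin 2)) (i : Fin 2) :
    gradMap P x i = polyFun (pderiv i P) x := by
  have h : inner ℝ (gradMap P x) (EuclideanSpace.single i (1 : ℝ)) = partialDeriv i (polyFun P) x :=
    InnerProductSpace.toDual_symm_apply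
  rw [EuclideanSpace.inner_single_right, partialDeriv_polyFun] at h
  simpa using h

theorem contDiff_gradMap (P : MvPolynomial (Fin 2) ℝ) : ContDiff ℝ ∞ (gradMap P) := by
  refine contDiff_euclidean.mpr fun i => ?_
  simp only [gradMap_apply]
  exact contDiff_polyFun _

theorem polyFun_pderiv_comm (P : MvPolynomial (Fin 2) ℝ) (x : EuclideanSpace ℝ (Fin 2)) :
    polyFun (pderiv 0 (pderiv 1 P)) x = polyFun (pderiv 1 (pderiv 0 P)) x := by
  simp only [← partialDeriv_polyFun]
  exact partialDeriv_comm (contDiff_polyFun P) 0 1 x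

theorem det_fderiv_gradMap (P : MvPolynomial (Fin 2) ℝ) (x : EuclideanSpace ℝ (Fin 2)) :
    (fderiv ℝ (gradMap P) x).det =
      polyFun (pderiv 0 (pderiv 0 P)) x * polyFun (pderiv 1 (pderiv 1 P)) x -
        polyFun (pderiv 1 (pderiv 0 P)) x ^ 2 := by
  rw [det_fderiv_eq (contDiff_gradMap P)]
  simp only [gradMap_apply]
  change partialDeriv 0 (polyFun _) x * partialDeriv 1 (polyFun _) x -
    partialDeriv 1 (polyFun _) x * partialDeriv 0 (polyFun _) x = _
  simp only [partialDeriv_polyFun, polyFun_pderiv_comm]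
  ring

theorem MvPolynomial.IsHomogeneous.polyFun_smul {P : MvPolynomial (Fin 2) ℝ} {k : ℕ}
    (hP : P.IsHomogeneous k) (r : ℝ) (x : EuclideanSpace ℝ (Fin 2)) :
    polyFun P (r • x) = r ^ k * polyFun P x := by
  simp only [polyFun, eval_eq, PiLp.smul_apply, smul_eq_mul]
  rw [Finset.mul_sum]
  refine Finset.sum_congr rfl fun d hd => ?_
  have hdeg : ∑ i ∈ d.support, d i = k := by
    have := hP (mem_support_iff.mp hd)
    rw [Finsupp.weight_apply, Finsupp.sum] at this
    simpa using this
  simp only [mul_pow]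
  rw [Finset.prod_mul_distrib, Finset.prod_pow_eq_pow_sum, hdeg]
  ring

theorem MvPolynomial.IsHomogeneous.euler_polyFun {P : MvPolynomial (Fin 2) ℝ} {k : ℕ}
    (hP : P.IsHomogeneous k) (x : EuclideanSpace ℝ (Fin 2)) :
    x 0 * polyFun (pderiv 0 P) x + x 1 * polyFun (pderiv 1 P) x = k * polyFun P x := by
  have := congrArg (fun Q => polyFun Q x) hP.sum_X_mul_pderiv
  simpa [polyFun, Fin.sum_univ_two] using this

end PlanePolynomial

/-! ### Admissible polynomials and finiteness of the nodal lines -/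

section Admissible

variable {N : ℕ} {P : MvPolynomial (Fin 2) ℝ}

open MvPolynomial

theorem IsAdmissiblePoly.isHomogeneous_pderiv (hP : IsAdmissiblePoly N P) (i : Fin 2) :
    (pderiv i P).IsHomogeneous N := hP.homogeneous.pderiv

theorem IsAdmissiblePoly.gradMap_smul (hP : IsAdmissiblePoly N P) (r : ℝ)
    (x : EuclideanSpace ℝ (Fin 2)) : gradMap P (r • x) = r ^ N • gradMap P x := by
  ext i
  simp only [gradMap_apply, PiLp.smul_apply, smul_eq_mul]
  exact (hP.isHomogeneous_pderiv i).polyFun_smul r x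

/-- For `N = 0` the gradient would be constant; being 0 at the origin, it would be 0 everywhere. -/
theorem IsAdmissiblePoly.one_le (hP : IsAdmissiblePoly N P) : 1 ≤ N := by
  by_contra! h
  obtain rfl : N = 0 := by omega
  have h0 : gradMap P 0 = 0 := (hP.critical_iff 0).mpr rfl
  have h1 := hP.gradMap_smul 0 (EuclideanSpace.single 0 1)
  rw [zero_smul, h0, pow_zero, one_smul] at h1
  have := (hP.critical_iff _).mp h1.symm
  simpa using congrArg (fun v : EuclideanSpace ℝ (Fin 2) => v 0) this

theorem IsAdmissiblePoly.exists_polyFun_ne_zero (hP : IsAdmissiblePoly N P) :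
    ∃ u, polyFun P u ≠ 0 := by
  by_contra! h
  have h1 : polyFun P = fun _ => 0 := funext h
  have h2 : gradMap P (EuclideanSpace.single 0 1) = 0 := by
    ext i
    rw [gradMap_apply, ← partialDeriv_polyFun, h1]
    simp [partialDeriv]
  have := (hP.critical_iff _).mp h2
  simpa using congrArg (fun v : EuclideanSpace ℝ (Fin 2) => v 0) this

/-- Choose `u` with `P u ≠ 0` and `w` orthogonal to `u`. No nodal line is parallel to `u`, so each
one meets the affine line `w + t u`, and is spanned by the meeting point. There `P` is a nonzero
polynomial in `t` of degree at most `N + 1`, and its roots bound the number of lines. -/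
theorem IsAdmissiblePoly.finite_nodalLines (hP : IsAdmissiblePoly N P) :
    (nodalLines P).Finite ∧ (nodalLines P).ncard ≤ N + 1 := by
  classical
  obtain ⟨u, hu⟩ := hP.exists_polyFun_ne_zero
  have hu0 : u ≠ 0 := by
    rintro rfl
    have := hP.homogeneous.polyFun_smul 0 (0 : EuclideanSpace ℝ (Fin 2))
    rw [smul_zero] at this
    exact hu (by rw [this]; simp)
  set w : EuclideanSpace ℝ (Fin 2) := !₂[-u 1, u 0] with hw
  set q : Polynomial ℝ := aeval (fun i => Polynomial.C (w i) + Polynomial.C (u i) * Polynomial.X) P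
    with hq
  have hqe : ∀ t, q.eval t = polyFun P (w + t • u) := by
    intro t
    rw [hq, polyFun, ← Polynomial.coe_aeval_eq_eval, ← aeval_eq_eval, ← AlgHom.comp_apply]
    congr 1
    ext i
    simp only [AlgHom.comp_apply, aeval_X]
    simp only [map_add, map_mul, Polynomial.aeval_C, Polynomial.aeval_X, PiLp.add_apply,
      PiLp.smul_apply, smul_eq_mul, Algebra.algebraMap_self, RingHom.id_apply]
    ring
  have hdeg : q.natDegree ≤ N + 1 := by
    have := MvPolynomial.aeval_natDegree_le (m := N + 1) (n := 1) P hP.homogeneous.totalDegree_le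
      (fun i => Polynomial.C (w i) + Polynomial.C (u i) * Polynomial.X) (fun i => by
        compute_degree)
    simpa using this
  -- If `q = 0`, homogeneity makes `P` vanish at `u + s w` for all `s ≠ 0`, and continuity at `s =
  -- 0` contradicts `P u ≠ 0`.
  have hq0 : q ≠ 0 := by
    intro h
    have hz : ∀ s : ℝ, s ≠ 0 → polyFun P (u + s • w) = 0 := by
      intro s hs
      have : u + s • w = s • (w + s⁻¹ • u) := by
        rw [smul_add, smul_smul, mul_inv_cancel₀ hs, one_smul, add_comm]
      rw [this, hP.homogeneous.polyFun_smul, ← hqe, h]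
      simp
    have hc : Continuous fun s : ℝ => polyFun P (u + s • w) :=
      (contDiff_polyFun P).continuous.comp (by fun_prop)
    have := hc.ext_on (dense_compl_singleton (0 : ℝ)) continuous_const
      (fun s hs => hz s hs)
    exact hu (by simpa using congrFun this 0)
  have hsub : nodalLines P ⊆
      (q.roots.toFinset.image fun t : ℝ => Submodule.span ℝ {w + t • u} : Finset _) := by
    rintro L ⟨hL1, hL⟩
    obtain ⟨⟨v, hvL⟩, hv0, hspan⟩ := finrank_eq_one_iff'.mp hL1
    have hv0' : v ≠ 0 := fun h => hv0 (Subtype.ext h)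
    have hnorm : u 0 ^ 2 + u 1 ^ 2 ≠ 0 := by
      intro h
      apply hu0
      ext i
      fin_cases i <;> simp <;> nlinarith [sq_nonneg (u 0), sq_nonneg (u 1)]
    obtain ⟨α, β, hαβ⟩ : ∃ α β : ℝ, v = α • w + β • u := by
      refine ⟨(-u 1 * v 0 + u 0 * v 1) / (u 0 ^ 2 + u 1 ^ 2),
        (u 0 * v 0 + u 1 * v 1) / (u 0 ^ 2 + u 1 ^ 2), ?_⟩
      ext i
      fin_cases i <;> simp [hw] <;> field_simp <;> ring
    have hα : α ≠ 0 := by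
      rintro rfl
      have h1 := hL v hvL
      rw [hαβ, zero_smul, zero_add, hP.homogeneous.polyFun_smul] at h1
      rcases mul_eq_zero.mp h1 with h | h
      · have hβ : β = 0 := by simpa using h
        exact hv0' (by simp [hαβ, hβ])
      · exact hu h
    have hmem : w + (β / α) • u ∈ L := by
      have : w + (β / α) • u = α⁻¹ • v := by
        rw [hαβ, smul_add, smul_smul, smul_smul, inv_mul_cancel₀ hα, one_smul, div_eq_inv_mul]
      rw [this]
      exact L.smul_mem _ hvL
    simp only [Finset.coe_image, mem_image, Finset.mem_coe, Multiset.mem_toFinset]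
    refine ⟨β / α, ?_, ?_⟩
    · rw [Polynomial.mem_roots hq0, Polynomial.IsRoot, hqe]
      exact hL _ hmem
    · have hle : Submodule.span ℝ {w + (β / α) • u} ≤ L :=
        (Submodule.span_singleton_le_iff_mem _ _).mpr hmem
      refine Submodule.eq_of_le_of_finrank_eq hle ?_
      rw [hL1, finrank_span_singleton]
      intro h
      have : v = α • (w + (β / α) • u) := by
        rw [hαβ, smul_add, smul_smul, mul_div_cancel₀ _ hα]
      rw [h, smul_zero] at this
      exact hv0' this
  refine ⟨(Finset.finite_toSet _).subset hsub, ?_⟩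
  calc (nodalLines P).ncard ≤ _ := Set.ncard_le_ncard hsub (Finset.finite_toSet _)
    _ = _ := Set.ncard_coe_finset _
    _ ≤ q.roots.toFinset.card := Finset.card_image_le
    _ ≤ q.roots.card := Multiset.toFinset_card_le _
    _ ≤ q.natDegree := Polynomial.card_roots' q
    _ ≤ N + 1 := hdeg

end Admissible

/-! ### Rotation of a plane curve counted by its axis crossings -/

section WindingIntegral

open Classical in
/-- The rotation of the plane curve `(A, B)` is determined by the zeros of `A` if they are all
crossed clockwise. -/
theorem integral_rotation_eq {A B A' B' : ℝ → ℝ} (hA : ∀ x, HasDerivAt A (A' x) x)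
    (hB : ∀ x, HasDerivAt B (B' x) x) (hA'c : Continuous A') (hB'c : Continuous B')
    (hne : ∀ x, A x ^ 2 + B x ^ 2 ≠ 0) (hcross : ∀ x, A x = 0 → 0 < A' x / B x)
    {a b : ℝ} (hab : a ≤ b) (ha : A a ≠ 0) (hb : A b ≠ 0) (Z : Finset ℝ)
    (hZ : ∀ x, x ∈ Z ↔ x ∈ Ioo a b ∧ A x = 0) :
    ∫ x in a..b, (A x * B' x - A' x * B x) / (A x ^ 2 + B x ^ 2) =
      Real.arctan (B b / A b) - Real.arctan (B a / A a) - Real.pi * Z.card := by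
  set rot := fun x => (A x * B' x - A' x * B x) / (A x ^ 2 + B x ^ 2) with hrot
  have hAc : Continuous A := continuous_iff_continuousAt.mpr fun x => (hA x).continuousAt
  have hBc : Continuous B := continuous_iff_continuousAt.mpr fun x => (hB x).continuousAt
  have hrotc : Continuous rot :=
    ((hAc.mul hB'c).sub (hA'c.mul hBc)).div ((hAc.pow 2).add (hBc.pow 2)) hne
  -- At each zero of `A` the quotient `B / A` passes from `-∞` to `+∞`, so `T` jumps up by `π`. Its
  -- value `π / 2` there is the limit from the right, which matches `n`, the number of zeros up to
  -- and including `x`. Thus `T - π n` is a continuous angle, and `D` turns out to be constant.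
  set T : ℝ → ℝ := fun x => if A x = 0 then Real.pi / 2 else Real.arctan (B x / A x) with hT
  set n : ℝ → ℝ := fun x => ((Z.filter (· ≤ x)).card : ℝ) with hn
  set D : ℝ → ℝ := fun x => (∫ y in a..x, rot y) - T x + Real.pi * n x with hD
  have hFTC : ∀ c, HasDerivAt (fun x => ∫ y in a..x, rot y) (rot c) c := fun c =>
    intervalIntegral.integral_hasDerivAt_right (hrotc.intervalIntegrable _ _)
      (hrotc.stronglyMeasurableAtFilter _ _) hrotc.continuousAt
  have hsep : ∀ c, ∀ᶠ x in 𝓝 c, ∀ z ∈ Z, z ≠ c → (z ≤ x ↔ z ≤ c) := by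
    intro c
    rw [eventually_all_finset]
    intro z _
    rcases lt_trichotomy z c with h | h | h
    · filter_upwards [eventually_gt_nhds h] with x hx _
      exact ⟨fun _ => h.le, fun _ => hx.le⟩
    · exact Eventually.of_forall fun x hx => absurd h hx
    · filter_upwards [eventually_lt_nhds h] with x hx _
      exact ⟨fun h' => absurd h' (not_le.mpr hx), fun h' => absurd h' (not_le.mpr h)⟩
  have hderiv : ∀ c ∈ Icc a b, HasDerivAt D 0 c := by
    intro c hc
    by_cases hAc0 : A c = 0
    · have hcZ : c ∈ Z := by
        rw [hZ]
        refine ⟨⟨lt_of_le_of_ne hc.1 ?_, lt_of_le_of_ne hc.2 ?_⟩, hAc0⟩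
        · rintro rfl
          exact ha hAc0
        · rintro rfl
          exact hb hAc0
      have hBc0 : B c ≠ 0 := by
        intro h
        exact hne c (by rw [hAc0, h]; ring)
      have hquot : HasDerivAt (fun x => A x / B x) ((A' c * B c - A c * B' c) / B c ^ 2) c :=
        (hA c).div (hB c) hBc0
      have hpos : 0 < deriv (fun x => A x / B x) c := by
        rw [hquot.deriv, hAc0]
        have := hcross c hAc0
        have e : (A' c * B c - 0 * B' c) / B c ^ 2 = A' c / B c := by
          field_simp
          ring
        rwa [e]
      have hsgn := eventually_nhdsWithin_sign_eq_of_deriv_pos hpos (by simp [hAc0])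
      -- Near a crossing the angle is rewritten through `A / B`, which is smooth there. The two
      -- forms `±π / 2 - arctan (A / B)` on either side differ by `π`, exactly the step of `π n`.
      have hev : D =ᶠ[𝓝 c] fun x => (∫ y in a..x, rot y) + Real.arctan (A x / B x) +
          (Real.pi * n c - Real.pi / 2) := by
        filter_upwards [hsgn, hsep c, (hBc.continuousAt (x := c)).eventually_ne hBc0]
          with x hx hsx hBx
        rcases lt_trichotomy x c with h | h | h
        · have hneg : A x / B x < 0 := by
            rwa [sign_neg (sub_neg.mpr h), sign_eq_neg_one_iff] at hx
          have hAx : A x ≠ 0 := by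
            rintro h0
            simp [h0] at hneg
          have hTx : T x = -(Real.pi / 2) - Real.arctan (A x / B x) := by
            simp only [hT, if_neg hAx]
            rw [← Real.arctan_inv_of_neg hneg, inv_div]
          have hnx : n c = n x + 1 := by
            have : Z.filter (· ≤ c) = insert c (Z.filter (· ≤ x)) := by
              ext z
              simp only [Finset.mem_filter, Finset.mem_insert]
              by_cases hzc : z = c
              · simp [hzc, hcZ]
              · simp only [hzc, false_or]
                exact and_congr_right fun hz => (hsx z hz hzc).symm
            simp only [hn]
            rw [this, Finset.card_insert_of_notMem (by simp [h])]
            push_cast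
            ring
          simp only [hD, hTx, hnx]
          ring
        · subst h
          simp only [hD, hT, hAc0, if_true, zero_div, Real.arctan_zero]
          ring
        · have hpos' : 0 < A x / B x := by
            rwa [sign_pos (sub_pos.mpr h), sign_eq_one_iff] at hx
          have hAx : A x ≠ 0 := by
            rintro h0
            simp [h0] at hpos'
          have hTx : T x = Real.pi / 2 - Real.arctan (A x / B x) := by
            simp only [hT, if_neg hAx]
            rw [← Real.arctan_inv_of_pos hpos', inv_div]
          have hnx : n x = n c := by
            simp only [hn]
            congr 2
            ext z
            simp only [Finset.mem_filter]
            refine and_congr_right fun hz => ?_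
            by_cases hzc : z = c
            · simp [hzc, h.le]
            · exact hsx z hz hzc
          simp only [hD, hTx, hnx]
          ring
      refine HasDerivAt.congr_of_eventuallyEq ?_ hev
      refine (((hFTC c).add hquot.arctan).add_const _).congr_deriv ?_
      have h2 := hne c
      simp only [hrot]
      have h3 : B c ^ 2 + A c ^ 2 ≠ 0 := by rwa [add_comm]
      field_simp
      ring
    · have hquot : HasDerivAt (fun x => B x / A x) ((B' c * A c - B c * A' c) / A c ^ 2) c :=
        (hB c).div (hA c) hAc0
      have hev : D =ᶠ[𝓝 c] fun x => (∫ y in a..x, rot y) - Real.arctan (B x / A x) +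
          Real.pi * n c := by
        filter_upwards [hsep c, (hAc.continuousAt (x := c)).eventually_ne hAc0] with x hsx hAx
        have hnx : n x = n c := by
          simp only [hn]
          congr 2
          ext z
          simp only [Finset.mem_filter]
          refine and_congr_right fun hz => hsx z hz ?_
          rintro rfl
          exact hAc0 ((hZ _).mp hz).2
        simp only [hD, hT, if_neg hAx, hnx]
      refine HasDerivAt.congr_of_eventuallyEq ?_ hev
      refine (((hFTC c).sub hquot.arctan).add_const _).congr_deriv ?_
      have h2 := hne c
      simp only [hrot]
      field_simp
      ring
  have hconst := constant_of_has_deriv_right_zero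
    (fun x hx => (hderiv x hx).continuousAt.continuousWithinAt)
    (fun x hx => (hderiv x (Ico_subset_Icc_self hx)).hasDerivWithinAt) b (right_mem_Icc.mpr hab)
  have hna : n a = 0 := by
    simp only [hn]
    rw [Finset.filter_false_of_mem fun z hz => not_le.mpr ((hZ z).mp hz).1.1]
    simp
  have hnb : n b = Z.card := by
    simp only [hn]
    rw [Finset.filter_true_of_mem fun z hz => ((hZ z).mp hz).1.2.le]
  simp only [hD, hT, if_neg ha, if_neg hb, hna, hnb, intervalIntegral.integral_same] at hconst
  linarith

end WindingIntegral

/-! ### Parametrisation of the unit circle -/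

section UnitCircle

open MvPolynomial

/-- The unit vector of angle `θ`. -/
noncomputable def unitVec (θ : ℝ) : EuclideanSpace ℝ (Fin 2) := !₂[Real.cos θ, Real.sin θ]

@[simp] theorem unitVec_zero_coord (θ : ℝ) : unitVec θ 0 = Real.cos θ := rfl

@[simp] theorem unitVec_one_coord (θ : ℝ) : unitVec θ 1 = Real.sin θ := rfl

theorem norm_unitVec (θ : ℝ) : ‖unitVec θ‖ = 1 := by
  rw [EuclideanSpace.norm_eq]
  simp [Fin.sum_univ_two]

theorem unitVec_ne_zero (θ : ℝ) : unitVec θ ≠ 0 := by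
  rw [← norm_ne_zero_iff, norm_unitVec]
  exact one_ne_zero

theorem unitVec_add_pi (θ : ℝ) : unitVec (θ + Real.pi) = (-1 : ℝ) • unitVec θ := by
  ext i
  fin_cases i <;> simp [unitVec]

theorem continuous_unitVec : Continuous unitVec := by
  refine (PiLp.continuous_toLp 2 _).comp (continuous_pi fun i => ?_)
  fin_cases i <;> simp <;> fun_prop

theorem exists_eq_smul_unitVec (v : EuclideanSpace ℝ (Fin 2)) :
    ∃ θ, v = ‖v‖ • unitVec θ := by
  have hn : ‖(⟨v 0, v 1⟩ : ℂ)‖ = ‖v‖ := by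
    rw [EuclideanSpace.norm_eq, Complex.norm_eq_sqrt_sq_add_sq]
    simp [Fin.sum_univ_two]
  refine ⟨Complex.arg ⟨v 0, v 1⟩, ?_⟩
  ext i
  rw [← hn]
  fin_cases i
  · simp
  · simp

theorem exists_mem_Ico_eq_smul_unitVec (v : EuclideanSpace ℝ (Fin 2)) (a : ℝ) :
    ∃ θ ∈ Ico a (a + Real.pi), ∃ c : ℝ, v = c • unitVec θ := by
  obtain ⟨φ, hφ⟩ := exists_eq_smul_unitVec v
  have key : ∀ (k : ℤ) (ψ : ℝ), ∃ c : ℝ, unitVec (ψ + k * Real.pi) = c • unitVec ψ := by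
    intro k ψ
    refine ⟨(-1) ^ k, ?_⟩
    ext i
    fin_cases i
    · simpa using Real.cos_add_int_mul_pi ψ k
    · simpa using Real.sin_add_int_mul_pi ψ k
  obtain ⟨c, hc⟩ := key (toIcoDiv Real.pi_pos a φ) (toIcoMod Real.pi_pos a φ)
  refine ⟨_, toIcoMod_mem_Ico Real.pi_pos a φ, ‖v‖ * c, ?_⟩
  have hadd := toIcoMod_add_toIcoDiv_zsmul Real.pi_pos a φ
  rw [zsmul_eq_mul] at hadd
  rw [hadd] at hc
  rw [← smul_smul, ← hc]
  exact hφ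

theorem hasDerivAt_polyFun_unitVec (P : MvPolynomial (Fin 2) ℝ) (θ : ℝ) :
    HasDerivAt (fun x => polyFun P (unitVec x))
      (-polyFun (pderiv 0 P) (unitVec θ) * Real.sin θ +
        polyFun (pderiv 1 P) (unitVec θ) * Real.cos θ) θ := by
  have he : HasDerivAt unitVec !₂[-Real.sin θ, Real.cos θ] θ := by
    rw [hasDerivAt_iff_hasFDerivAt]
    refine hasFDerivWithinAt_univ.mp (hasFDerivWithinAt_euclidean.mpr fun i => ?_)
    rw [hasFDerivWithinAt_univ]
    fin_cases i
    · refine (Real.hasDerivAt_cos θ).hasFDerivAt.congr_fderiv ?_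
      ext
      simp
    · refine (Real.hasDerivAt_sin θ).hasFDerivAt.congr_fderiv ?_
      ext
      simp
  refine ((hasFDerivAt_polyFun P (unitVec θ)).comp_hasDerivAt θ he).congr_deriv ?_
  simp [Fin.sum_univ_two]

end UnitCircle

/-! ### The angular integral of the gradient -/

section AngularIntegral

open MvPolynomial

variable {N : ℕ} {P : MvPolynomial (Fin 2) ℝ}

theorem injOn_span_unitVec (a : ℝ) :
    InjOn (fun θ => Submodule.span ℝ {unitVec θ}) (Ioo a (a + Real.pi)) := by
  intro θ hθ φ hφ h
  have hmem : unitVec θ ∈ Submodule.span ℝ {unitVec φ} :=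
    h.le (Submodule.mem_span_singleton_self (unitVec θ))
  obtain ⟨c, hc⟩ := Submodule.mem_span_singleton.mp hmem
  have h0 : c * Real.cos φ = Real.cos θ := congrArg (fun v : EuclideanSpace ℝ (Fin 2) => v 0) hc
  have h1 : c * Real.sin φ = Real.sin θ := congrArg (fun v : EuclideanSpace ℝ (Fin 2) => v 1) hc
  have hs : Real.sin (θ - φ) = 0 := by
    rw [Real.sin_sub, ← h0, ← h1]
    ring
  have := (Real.sin_eq_zero_iff_of_lt_of_lt (by linarith [hθ.1, hφ.2])
    (by linarith [hθ.2, hφ.1])).mp hs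
  linarith

/-- Every line has a direction in the half-open half-circle from `a`. Starting at a non-nodal angle
allows the open interval, so that no crossing sits at an end point. -/
theorem IsAdmissiblePoly.nodalLines_eq_image (hP : IsAdmissiblePoly N P) {a : ℝ}
    (ha : polyFun P (unitVec a) ≠ 0) :
    nodalLines P = (fun θ => Submodule.span ℝ {unitVec θ}) ''
      {θ | θ ∈ Ioo a (a + Real.pi) ∧ polyFun P (unitVec θ) = 0} := by
  ext L
  constructor
  · rintro ⟨hL1, hL⟩
    obtain ⟨⟨v, hvL⟩, hv0, -⟩ := finrank_eq_one_iff'.mp hL1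
    have hv0' : v ≠ 0 := fun h => hv0 (Subtype.ext h)
    obtain ⟨θ, hθ, c, hc⟩ := exists_mem_Ico_eq_smul_unitVec v a
    have hc0 : c ≠ 0 := by
      rintro rfl
      exact hv0' (by rw [hc, zero_smul])
    have hmem : unitVec θ ∈ L := by
      have : unitVec θ = c⁻¹ • v := by rw [hc, smul_smul, inv_mul_cancel₀ hc0, one_smul]
      rw [this]
      exact L.smul_mem _ hvL
    have hz := hL _ hmem
    refine ⟨θ, ⟨⟨lt_of_le_of_ne hθ.1 ?_, hθ.2⟩, hz⟩, ?_⟩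
    · rintro rfl
      exact ha hz
    · refine Submodule.eq_of_le_of_finrank_eq
        ((Submodule.span_singleton_le_iff_mem _ _).mpr hmem) ?_
      rw [hL1, finrank_span_singleton (unitVec_ne_zero θ)]
  · rintro ⟨θ, ⟨-, hz⟩, rfl⟩
    refine ⟨finrank_span_singleton (unitVec_ne_zero θ), fun ξ hξ => ?_⟩
    obtain ⟨c, rfl⟩ := Submodule.mem_span_singleton.mp hξ
    rw [hP.homogeneous.polyFun_smul, hz, mul_zero]

theorem IsAdmissiblePoly.exists_polyFun_unitVec_ne_zero (hP : IsAdmissiblePoly N P) :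
    ∃ a, polyFun P (unitVec a) ≠ 0 := by
  obtain ⟨u, hu⟩ := hP.exists_polyFun_ne_zero
  obtain ⟨a, ha⟩ := exists_eq_smul_unitVec u
  refine ⟨a, fun h => hu ?_⟩
  rw [ha, hP.homogeneous.polyFun_smul, h, mul_zero]

theorem norm_gradMap_sq (P : MvPolynomial (Fin 2) ℝ) (x : EuclideanSpace ℝ (Fin 2)) :
    ‖gradMap P x‖ ^ 2 = polyFun (pderiv 0 P) x ^ 2 + polyFun (pderiv 1 P) x ^ 2 := by
  rw [EuclideanSpace.norm_sq_eq, Fin.sum_univ_two, gradMap_apply, gradMap_apply]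
  simp

theorem IsAdmissiblePoly.isHomogeneous_pderiv_pderiv (hP : IsAdmissiblePoly N P) (i j : Fin 2) :
    (pderiv i (pderiv j P)).IsHomogeneous (N - 1) := (hP.isHomogeneous_pderiv j).pderiv

theorem IsAdmissiblePoly.gradMap_unitVec_ne_zero (hP : IsAdmissiblePoly N P) (θ : ℝ) :
    gradMap P (unitVec θ) ≠ 0 := fun h => unitVec_ne_zero θ ((hP.critical_iff _).mp h)

/-- The total rotation of the gradient along the unit circle. -/
theorem IsAdmissiblePoly.integral_det_div_norm_sq (hP : IsAdmissiblePoly N P) :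
    ∫ θ in -Real.pi..Real.pi, (fderiv ℝ (gradMap P) (unitVec θ)).det /
        (N * ‖gradMap P (unitVec θ)‖ ^ 2) =
      2 * Real.pi * (1 - (nodalLines P).ncard) := by
  have hN : (N : ℝ) ≠ 0 := by
    have := hP.one_le
    positivity
  set p := fun θ => polyFun P (unitVec θ) with hp
  set u := fun θ => polyFun (pderiv 0 P) (unitVec θ) with hu
  set v := fun θ => polyFun (pderiv 1 P) (unitVec θ) with hv
  set xx := fun θ => polyFun (pderiv 0 (pderiv 0 P)) (unitVec θ) with hxx
  set xy := fun θ => polyFun (pderiv 1 (pderiv 0 P)) (unitVec θ) with hxy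
  set yy := fun θ => polyFun (pderiv 1 (pderiv 1 P)) (unitVec θ) with hyy
  -- `A` and `B` are the radial and tangential components of the gradient (for `A` this is Euler's
  -- identity, `hAeuler`). As `B` is the derivative of `p`, the crossing condition holds with `A' /
  -- B = N + 1`.
  set A := fun θ => (N + 1 : ℝ) * p θ with hA
  set B := fun θ => -u θ * Real.sin θ + v θ * Real.cos θ with hB
  set A' := fun θ => (N + 1 : ℝ) * B θ with hA'
  set B' := fun θ => -((-xx θ * Real.sin θ + xy θ * Real.cos θ) * Real.sin θ + u θ * Real.cos θ) +
    ((-xy θ * Real.sin θ + yy θ * Real.cos θ) * Real.cos θ - v θ * Real.sin θ) with hB'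
  have hpd : ∀ θ, HasDerivAt p (B θ) θ := hasDerivAt_polyFun_unitVec P
  have hud : ∀ θ, HasDerivAt u (-xx θ * Real.sin θ + xy θ * Real.cos θ) θ :=
    hasDerivAt_polyFun_unitVec (pderiv 0 P)
  have hvd : ∀ θ, HasDerivAt v (-xy θ * Real.sin θ + yy θ * Real.cos θ) θ := fun θ => by
    have := hasDerivAt_polyFun_unitVec (pderiv 1 P) θ
    rwa [polyFun_pderiv_comm] at this
  have hAd : ∀ θ, HasDerivAt A (A' θ) θ := fun θ => (hpd θ).const_mul _
  have hBd : ∀ θ, HasDerivAt B (B' θ) θ := fun θ => by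
    refine (((hud θ).neg.mul (Real.hasDerivAt_sin θ)).add
      ((hvd θ).mul (Real.hasDerivAt_cos θ))).congr_deriv ?_
    simp only [hB', Pi.neg_apply]
    ring
  have hcont : ∀ Q : MvPolynomial (Fin 2) ℝ, Continuous fun θ => polyFun Q (unitVec θ) :=
    fun Q => (contDiff_polyFun Q).continuous.comp continuous_unitVec
  have hpc : Continuous p := hcont _
  have huc : Continuous u := hcont _
  have hvc : Continuous v := hcont _
  have hxxc : Continuous xx := hcont _
  have hxyc : Continuous xy := hcont _
  have hyyc : Continuous yy := hcont _
  have hBc : Continuous B := by fun_prop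
  have hA'c : Continuous A' := by fun_prop
  have hB'c : Continuous B' := by fun_prop
  have hsc := Real.sin_sq_add_cos_sq
  have hAeuler : ∀ θ, A θ = Real.cos θ * u θ + Real.sin θ * v θ := fun θ => by
    have := hP.homogeneous.euler_polyFun (unitVec θ)
    push_cast at this
    exact this.symm
  have hnorm : ∀ θ, A θ ^ 2 + B θ ^ 2 = ‖gradMap P (unitVec θ)‖ ^ 2 := fun θ => by
    rw [norm_gradMap_sq, hAeuler]
    linear_combination (u θ ^ 2 + v θ ^ 2) * hsc θ
  have hne : ∀ θ, A θ ^ 2 + B θ ^ 2 ≠ 0 := fun θ => by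
    rw [hnorm]
    exact pow_ne_zero 2 (norm_ne_zero_iff.mpr (hP.gradMap_unitVec_ne_zero θ))
  have hcross : ∀ θ, A θ = 0 → 0 < A' θ / B θ := fun θ h => by
    have hB0 : B θ ≠ 0 := fun h' => hne θ (by rw [h, h']; ring)
    simp only [hA']
    rw [mul_div_assoc, div_self hB0]
    positivity
  have hinteg : ∀ θ, (fderiv ℝ (gradMap P) (unitVec θ)).det /
      (N * ‖gradMap P (unitVec θ)‖ ^ 2) =
      1 + (A θ * B' θ - A' θ * B θ) / (A θ ^ 2 + B θ ^ 2) := fun θ => by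
    have e0 : Real.cos θ * xx θ + Real.sin θ * xy θ = N * u θ :=
      (hP.isHomogeneous_pderiv 0).euler_polyFun (unitVec θ)
    have e1 : Real.cos θ * xy θ + Real.sin θ * yy θ = N * v θ := by
      have := (hP.isHomogeneous_pderiv 1).euler_polyFun (unitVec θ)
      rwa [polyFun_pderiv_comm] at this
    have hdet : (fderiv ℝ (gradMap P) (unitVec θ)).det = xx θ * yy θ - xy θ ^ 2 :=
      det_fderiv_gradMap P (unitVec θ)
    have hne' := hne θ
    -- In the orthonormal frame of radial and tangential directions the Hessian has entries `N A`,
    -- `N B` and `A + B'`. Its determinant `N A (A + B') - (N B) ^ 2` becomes the right-hand side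
    -- through `A' = (N + 1) B`.
    have key : xx θ * yy θ - xy θ ^ 2 =
        N * (A θ ^ 2 + B θ ^ 2 + (A θ * B' θ - A' θ * B θ)) := by
      have hNA : N * A θ = xx θ * Real.cos θ ^ 2 + 2 * xy θ * Real.cos θ * Real.sin θ +
          yy θ * Real.sin θ ^ 2 := by
        rw [hAeuler]
        linear_combination -Real.cos θ * e0 - Real.sin θ * e1
      have hNB : N * B θ = (yy θ - xx θ) * Real.sin θ * Real.cos θ +
          xy θ * (Real.cos θ ^ 2 - Real.sin θ ^ 2) := by
        simp only [hB]
        linear_combination Real.sin θ * e0 - Real.cos θ * e1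
      have hB'A : B' θ = -A θ + (xx θ * Real.sin θ ^ 2 - 2 * xy θ * Real.sin θ * Real.cos θ +
          yy θ * Real.cos θ ^ 2) := by
        rw [hAeuler]
        simp only [hB']
        ring
      have hgoal : (N : ℝ) * (A θ ^ 2 + B θ ^ 2 + (A θ * B' θ - A' θ * B θ)) =
          (N * A θ) * (xx θ * Real.sin θ ^ 2 - 2 * xy θ * Real.sin θ * Real.cos θ +
          yy θ * Real.cos θ ^ 2) - (N * B θ) ^ 2 := by
        rw [hB'A]
        simp only [hA']
        ring
      rw [hgoal, hNA, hNB]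
      have h2 : (Real.sin θ ^ 2 + Real.cos θ ^ 2) ^ 2 = 1 := by rw [hsc θ]; ring
      linear_combination -(xx θ * yy θ - xy θ ^ 2) * h2
    rw [← hnorm, hdet, key]
    field_simp
  obtain ⟨a, ha⟩ := hP.exists_polyFun_unitVec_ne_zero
  have hfin : {θ | θ ∈ Ioo a (a + Real.pi) ∧ polyFun P (unitVec θ) = 0}.Finite := by
    refine Set.Finite.of_finite_image ?_ ((injOn_span_unitVec a).mono fun θ hθ => hθ.1)
    rw [← hP.nodalLines_eq_image ha]
    exact hP.finite_nodalLines.1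
  have hcard : (nodalLines P).ncard = hfin.toFinset.card := by
    rw [hP.nodalLines_eq_image ha,
      ((injOn_span_unitVec a).mono fun θ hθ => hθ.1).ncard_image,
      ncard_eq_toFinset_card _ hfin]
  have hN1 : (N + 1 : ℝ) ≠ 0 := by positivity
  have hgrad_pi : ∀ θ, gradMap P (unitVec (θ + Real.pi)) = (-1 : ℝ) ^ N • gradMap P (unitVec θ) :=
    fun θ => by rw [unitVec_add_pi, hP.gradMap_smul]
  have hp_pi : ∀ θ, A (θ + Real.pi) = (-1) ^ (N + 1) * A θ := fun θ => by
    simp only [hA, hp]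
    rw [unitVec_add_pi, hP.homogeneous.polyFun_smul]
    ring
  have hu_pi : ∀ θ, u (θ + Real.pi) = (-1) ^ N * u θ := fun θ => by
    simp only [hu]
    rw [unitVec_add_pi, (hP.isHomogeneous_pderiv 0).polyFun_smul]
  have hv_pi : ∀ θ, v (θ + Real.pi) = (-1) ^ N * v θ := fun θ => by
    simp only [hv]
    rw [unitVec_add_pi, (hP.isHomogeneous_pderiv 1).polyFun_smul]
  have hB_pi : ∀ θ, B (θ + Real.pi) = (-1) ^ (N + 1) * B θ := fun θ => by
    simp only [hB]
    rw [hu_pi, hv_pi, Real.sin_add_pi, Real.cos_add_pi]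
    ring
  have haA : A a ≠ 0 := mul_ne_zero hN1 ha
  have hbA : A (a + Real.pi) ≠ 0 := by
    rw [hp_pi]
    exact mul_ne_zero (pow_ne_zero _ (by norm_num)) haA
  have hrot := integral_rotation_eq hAd hBd hA'c hB'c hne hcross
    (le_add_of_nonneg_right Real.pi_pos.le) haA hbA hfin.toFinset (by
      intro x
      simp [hA, hN1, hp])
  -- `A` and `B` change by the same sign under `θ ↦ θ + π`, so the arctangent terms cancel and the
  -- rotation over a half-circle is `-π` times the number of zeros.
  have hT : B (a + Real.pi) / A (a + Real.pi) = B a / A a := by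
    rw [hp_pi, hB_pi, mul_div_mul_left _ _ (pow_ne_zero _ (by norm_num))]
  rw [hT, sub_self, zero_sub] at hrot
  have hrotc : Continuous fun θ => (A θ * B' θ - A' θ * B θ) / (A θ ^ 2 + B θ ^ 2) := by
    refine Continuous.div ?_ ?_ hne <;> fun_prop
  set F := fun θ => 1 + (A θ * B' θ - A' θ * B θ) / (A θ ^ 2 + B θ ^ 2) with hF
  have hFc : Continuous F := continuous_const.add hrotc
  have hhalf : ∫ θ in a..a + Real.pi, F θ = Real.pi * (1 - (nodalLines P).ncard) := by
    simp only [hF]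
    rw [intervalIntegral.integral_add (by simp) (hrotc.intervalIntegrable _ _), hrot, hcard]
    simp
    ring
  -- Antipodal points contribute equally, so the full circle is twice the half-circle, wherever that
  -- begins.
  have hper : Function.Periodic F Real.pi := fun θ => by
    simp only [hF]
    rw [← hinteg, ← hinteg, hgrad_pi, unitVec_add_pi, det_fderiv_gradMap, det_fderiv_gradMap,
      (hP.isHomogeneous_pderiv_pderiv 0 0).polyFun_smul,
      (hP.isHomogeneous_pderiv_pderiv 1 0).polyFun_smul,
      (hP.isHomogeneous_pderiv_pderiv 1 1).polyFun_smul, norm_smul]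
    have h1 : ((-1 : ℝ) ^ (N - 1)) ^ 2 = 1 := by rw [← pow_mul, mul_comm, pow_mul]; simp
    congr 1
    · linear_combination (polyFun (pderiv 0 (pderiv 0 P)) (unitVec θ) *
        polyFun (pderiv 1 (pderiv 1 P)) (unitVec θ) -
        polyFun (pderiv 1 (pderiv 0 P)) (unitVec θ) ^ 2) * h1
    · simp
  simp_rw [hinteg]
  have hsplit := intervalIntegral.integral_add_adjacent_intervals
    (hFc.intervalIntegrable (μ := volume) (-Real.pi) 0)
    (hFc.intervalIntegrable (μ := volume) 0 Real.pi)
  have h1 := hper.intervalIntegral_add_eq (-Real.pi) a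
  have h2 := hper.intervalIntegral_add_eq 0 a
  rw [neg_add_cancel] at h1
  rw [zero_add] at h2
  rw [← hsplit, h1, h2, hhalf]
  ring

end AngularIntegral

/-! ### Polar coordinates and the radial substitution -/

section PolarIntegral

theorem integral_plane_eq_integral_prod (F : EuclideanSpace ℝ (Fin 2) → ℝ) :
    ∫ x, F x = ∫ z : ℝ × ℝ, F !₂[z.1, z.2] := by
  have h1 := (EuclideanSpace.volume_preserving_symm_measurableEquiv_toLp (Fin 2)).symm
  have h2 := (volume_preserving_finTwoArrow ℝ).symm
  rw [← h1.integral_comp (MeasurableEquiv.measurableEmbedding _),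
    ← h2.integral_comp (MeasurableEquiv.measurableEmbedding _)]
  rfl

/-- Integration in polar coordinates of a continuous function with compact support. -/
theorem integral_plane_eq_polar {F : EuclideanSpace ℝ (Fin 2) → ℝ} (hF : Continuous F)
    (hc : HasCompactSupport F) :
    ∫ x, F x = ∫ θ in -Real.pi..Real.pi, ∫ r in Ioi (0 : ℝ), r * F (r • unitVec θ) := by
  obtain ⟨R, hR⟩ := hc.isBounded.subset_closedBall 0
  have hzero : ∀ x, R < ‖x‖ → F x = 0 := fun x hx =>
    image_eq_zero_of_notMem_tsupport fun h => not_le.mpr hx (by simpa using hR h)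
  have hcont : Continuous fun z : ℝ × ℝ => z.2 * F (z.2 • unitVec z.1) :=
    continuous_snd.mul (hF.comp (continuous_snd.smul (continuous_unitVec.comp continuous_fst)))
  have hint : IntegrableOn (fun z : ℝ × ℝ => z.2 * F (z.2 • unitVec z.1))
      (Ioo (-Real.pi) Real.pi ×ˢ Ioi (0 : ℝ)) (volume.prod volume) := by
    have h1 : IntegrableOn (fun z : ℝ × ℝ => z.2 * F (z.2 • unitVec z.1))
        (Ioo (-Real.pi) Real.pi ×ˢ Ioc 0 R) (volume.prod volume) :=
      (hcont.continuousOn.integrableOn_compact (isCompact_Icc.prod isCompact_Icc)).mono_set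
        (prod_mono Ioo_subset_Icc_self Ioc_subset_Icc_self)
    refine h1.of_forall_sdiff_eq_zero (measurableSet_Ioo.prod measurableSet_Ioi) ?_
    rintro ⟨θ, r⟩ ⟨⟨hθ, hr⟩, hnot⟩
    have hr0 : 0 < r := hr
    have hRr : R < r := by
      by_contra! h
      exact hnot ⟨hθ, hr0, h⟩
    have : F (r • unitVec θ) = 0 := by
      apply hzero
      rwa [norm_smul, norm_unitVec, mul_one, Real.norm_of_nonneg hr0.le]
    simp [this]
  rw [integral_plane_eq_integral_prod, ← integral_comp_polarCoord_symm, polarCoord_target]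
  have hpolar : ∀ p : ℝ × ℝ, p.1 • F !₂[(polarCoord.symm p).1, (polarCoord.symm p).2] =
      p.1 * F (p.1 • unitVec p.2) := by
    intro p
    rw [smul_eq_mul]
    congr 2
    ext i
    fin_cases i <;> simp
  simp_rw [hpolar]
  rw [intervalIntegral.integral_of_le (by linarith [Real.pi_pos]), integral_Ioc_eq_integral_Ioo,
    ← setIntegral_prod _ hint]
  exact setIntegral_prod_swap (μ := volume) (ν := volume) (Ioo (-Real.pi) Real.pi) (Ioi (0 : ℝ))
    (fun p : ℝ × ℝ => p.2 * F (p.2 • unitVec p.1))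

/-- Substitute `s = r ^ N * ρ`: then `r ^ (2 * N - 1) dr = s ds / (N * ρ ^ 2)`. -/
theorem integral_radial_pow_comp {N : ℕ} (hN : 1 ≤ N) {ρ : ℝ} (hρ : 0 < ρ) (c : ℝ) (g : ℝ → ℝ) :
    ∫ r in Ioi (0 : ℝ), r * (g (r ^ N * ρ) * ((r ^ (N - 1)) ^ 2 * c)) =
      c / (N * ρ ^ 2) * ∫ s in Ioi (0 : ℝ), s * g s := by
  have hN0 : (0 : ℝ) < N := by positivity
  have h1 := integral_comp_rpow_Ioi_of_pos (g := fun y => y * g (y * ρ)) hN0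
  have h2 := integral_comp_mul_right_Ioi (fun s => s * g s) 0 hρ
  rw [zero_mul, smul_eq_mul] at h2
  have h3 : ∫ y in Ioi (0 : ℝ), y * g (y * ρ) = ρ⁻¹ * ∫ y in Ioi (0 : ℝ), y * ρ * g (y * ρ) := by
    rw [← integral_const_mul]
    congr 1
    funext y
    field_simp
  have h4 : ∫ r in Ioi (0 : ℝ), r * (g (r ^ N * ρ) * ((r ^ (N - 1)) ^ 2 * c)) =
      (c / N) * ∫ x in Ioi (0 : ℝ), ((N : ℝ) * x ^ ((N : ℝ) - 1)) •
        ((x ^ (N : ℝ)) * g (x ^ (N : ℝ) * ρ)) := by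
    rw [← integral_const_mul]
    refine setIntegral_congr_fun measurableSet_Ioi fun r hr => ?_
    have e : r ^ ((N : ℝ) - 1) = r ^ (N - 1) := by
      rw [← Real.rpow_natCast, Nat.cast_sub hN, Nat.cast_one]
    have e2 : r ^ N = r * r ^ (N - 1) := by rw [mul_comm, pow_sub_one_mul (by omega)]
    simp only [smul_eq_mul]
    rw [e, Real.rpow_natCast]
    field_simp
    rw [e2]
    ring
  rw [h4, h1, h3, h2]
  field_simp

end PolarIntegral

/-! ### The degree of the gradient map -/

section GradientDegree

variable {N : ℕ} {P : MvPolynomial (Fin 2) ℝ}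

theorem IsAdmissiblePoly.exists_le_norm_gradMap (hP : IsAdmissiblePoly N P) :
    ∃ c > 0, ∀ x, c * ‖x‖ ^ N ≤ ‖gradMap P x‖ := by
  obtain ⟨c, hc, h⟩ := exists_pos_le_norm_of_isCompact
    (isCompact_sphere (0 : EuclideanSpace ℝ (Fin 2)) 1)
    (contDiff_gradMap P).continuous.continuousOn (by
      intro x hx h0
      rw [(hP.critical_iff x).mp h0] at hx
      simp at hx)
  refine ⟨c, hc, fun x => ?_⟩
  obtain ⟨θ, hθ⟩ := exists_eq_smul_unitVec x
  have h1 := h (unitVec θ) (by simp [norm_unitVec])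
  conv_rhs => rw [hθ, hP.gradMap_smul, norm_smul, norm_pow, norm_norm]
  rw [mul_comm]
  gcongr

theorem IsAdmissiblePoly.det_fderiv_gradMap_smul (hP : IsAdmissiblePoly N P) (r : ℝ)
    (x : EuclideanSpace ℝ (Fin 2)) :
    (fderiv ℝ (gradMap P) (r • x)).det = (r ^ (N - 1)) ^ 2 * (fderiv ℝ (gradMap P) x).det := by
  simp only [det_fderiv_gradMap, (hP.isHomogeneous_pderiv_pderiv 0 0).polyFun_smul,
    (hP.isHomogeneous_pderiv_pderiv 1 0).polyFun_smul,
    (hP.isHomogeneous_pderiv_pderiv 1 1).polyFun_smul]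
  ring

/-- The integrand vanishes outside the ball, so the integral runs over the whole plane. By
homogeneity the radial integral in each direction is the angular density times one constant `κ`, and
the mass of the bump is `2π κ`. Nothing here requires 0 to be a regular value. -/
theorem IsAdmissiblePoly.degreeIntegral_gradMap (hP : IsAdmissiblePoly N P) {R ε : ℝ}
    (hε : 0 < ε) (hR : ∀ x, R ≤ ‖x‖ → ε ≤ ‖gradMap P x‖) :
    degreeIntegral (gradMap P) (ball 0 R) ε =
      (1 - (nodalLines P).ncard) * ∫ v : EuclideanSpace ℝ (Fin 2), radialBump ε v := by
  have hzero : ∀ x ∉ ball (0 : EuclideanSpace ℝ (Fin 2)) R,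
      radialBump ε (gradMap P x) * (fderiv ℝ (gradMap P) x).det = 0 := fun x hx => by
    rw [radialBump_eq_zero hε (hR x (by simpa using hx)), zero_mul]
  have hcont : Continuous fun x => radialBump ε (gradMap P x) * (fderiv ℝ (gradMap P) x).det :=
    ((continuous_radialBump ε).comp (contDiff_gradMap P).continuous).mul
      (continuous_det_fderiv (contDiff_gradMap P))
  have hcs : HasCompactSupport
      fun x => radialBump ε (gradMap P x) * (fderiv ℝ (gradMap P) x).det := by
    refine HasCompactSupport.of_support_subset_isCompact (isCompact_closedBall 0 R) fun x hx => ?_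
    by_contra h
    exact hx (hzero x fun h' => h (ball_subset_closedBall h'))
  set κ := ∫ s in Ioi (0 : ℝ), s * Real.smoothTransition (1 - s ^ 2 / ε ^ 2) with hκ
  have hbump : ∫ v : EuclideanSpace ℝ (Fin 2), radialBump ε v = 2 * Real.pi * κ := by
    rw [integral_plane_eq_polar (continuous_radialBump ε) (hasCompactSupport_radialBump hε)]
    simp only [radialBump, norm_smul, norm_unitVec, mul_one, Real.norm_eq_abs, sq_abs]
    rw [intervalIntegral.integral_const, smul_eq_mul]
    ring
  rw [degreeIntegral, setIntegral_eq_integral_of_forall_compl_eq_zero hzero,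
    integral_plane_eq_polar hcont hcs, hbump]
  have hinner : ∀ θ, ∫ r in Ioi (0 : ℝ), r * (radialBump ε (gradMap P (r • unitVec θ)) *
      (fderiv ℝ (gradMap P) (r • unitVec θ)).det) =
      (fderiv ℝ (gradMap P) (unitVec θ)).det / (N * ‖gradMap P (unitVec θ)‖ ^ 2) * κ := by
    intro θ
    rw [hκ, ← integral_radial_pow_comp hP.one_le
      (norm_pos_iff.mpr (hP.gradMap_unitVec_ne_zero θ))]
    refine setIntegral_congr_fun measurableSet_Ioi fun r hr => ?_
    have hr0 : (0 : ℝ) < r := hr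
    simp only [radialBump]
    rw [hP.gradMap_smul, hP.det_fderiv_gradMap_smul, norm_smul, norm_pow,
      Real.norm_of_nonneg hr0.le]
  simp_rw [hinner]
  rw [intervalIntegral.integral_mul_const, hP.integral_det_div_norm_sq]
  ring

/-- Rouché's condition: a displacement shorter than `a` cannot bring `a` to 0. -/
theorem add_smul_sub_ne_zero {F : Type*} [NormedAddCommGroup F] [NormedSpace ℝ F] {a b : F}
    (h : ‖b - a‖ < ‖a‖) {t : ℝ} (ht : t ∈ Icc (0 : ℝ) 1) : a + t • (b - a) ≠ 0 := by
  intro h0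
  have h1 : ‖a‖ = ‖t • (b - a)‖ := by
    rw [← norm_neg (t • (b - a)), ← eq_neg_of_add_eq_zero_left h0]
  rw [norm_smul, Real.norm_of_nonneg ht.1] at h1
  nlinarith [norm_nonneg (b - a), ht.2]

theorem fderiv_sub_const_fun {n : ℕ} (g : EuclideanSpace ℝ (Fin n) → EuclideanSpace ℝ (Fin n))
    (y x : EuclideanSpace ℝ (Fin n)) : fderiv ℝ (fun z => g z - y) x = fderiv ℝ g x :=
  fderiv_sub_const y

theorem signedCount_sub_const {n : ℕ}
    (g : EuclideanSpace ℝ (Fin n) → EuclideanSpace ℝ (Fin n))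
    (U : Set (EuclideanSpace ℝ (Fin n))) (y : EuclideanSpace ℝ (Fin n)) :
    signedCount (fun x => g x - y) U 0 = signedCount g U y := by
  simp only [signedCount, sub_eq_zero, fderiv_sub_const_fun]

/-- **Sard's theorem** in equal dimensions. -/
theorem ae_regular_value {n : ℕ} {g : EuclideanSpace ℝ (Fin n) → EuclideanSpace ℝ (Fin n)}
    (hg : ContDiff ℝ ∞ g) :
    ∀ᵐ y ∂(volume : Measure (EuclideanSpace ℝ (Fin n))), ∀ x, g x = y → (fderiv ℝ g x).det ≠ 0 := by
  have h := addHaar_image_eq_zero_of_det_fderivWithin_eq_zero (volume)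
    (s := {x | (fderiv ℝ g x).det = 0})
    (fun x _ => (hg.differentiable (by simp) x).hasFDerivAt.hasFDerivWithinAt) (fun x hx => hx)
  refine measure_mono_null (fun y hy => ?_) h
  simp only [mem_compl_iff, mem_ofPred_eq, not_forall, not_not] at hy
  obtain ⟨x, hx, hd⟩ := hy
  exact ⟨x, hd, hx⟩

/-- The bound `c ‖x‖ ^ N ≤ ‖∇P x‖` makes `∇P` larger than `y` on a large circle. There the
homotopies from `∇P` to `∇P - y` and on to `g - y` have no zeros, so the signed count of `g` is read
off from the degree integral of `∇P`. -/
theorem IsAdmissiblePoly.hasBrouwerDegree (hP : IsAdmissiblePoly N P)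
    (y : EuclideanSpace ℝ (Fin 2)) : ∃ R₀ > 0, ∀ R ≥ R₀,
      HasBrouwerDegree (gradMap P) (ball 0 R) y (1 - ((nodalLines P).ncard : ℤ)) := by
  obtain ⟨c, hc, hcP⟩ := hP.exists_le_norm_gradMap
  have hN : N ≠ 0 := by
    have := hP.one_le
    omega
  obtain ⟨R₀, hR₀, hlarge⟩ : ∃ R₀ > 0, ∀ R ≥ R₀, ‖y‖ < c * R ^ N := by
    have h : Tendsto (fun R : ℝ => c * R ^ N) atTop atTop :=
      (tendsto_pow_atTop hN).const_mul_atTop hc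
    obtain ⟨R₁, hR₁⟩ := eventually_atTop.mp (h.eventually_gt_atTop ‖y‖)
    exact ⟨max R₁ 1, by positivity, fun R hR => hR₁ R ((le_max_left _ _).trans hR)⟩
  refine ⟨R₀, hR₀, fun R hR => ?_⟩
  have hRpos : 0 < R := hR₀.trans_le hR
  have hyR := hlarge R hR
  have hf := contDiff_gradMap P
  have hfr : ∀ x ∈ frontier (ball (0 : EuclideanSpace ℝ (Fin 2)) R),
      c * R ^ N ≤ ‖gradMap P x‖ := by
    intro x hx
    rw [frontier_ball _ hRpos.ne'] at hx
    have : ‖x‖ = R := by simpa using hx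
    rw [← this]
    exact hcP x
  refine ⟨isOpen_ball, isBounded_ball, hf.continuous.continuousOn, ?_, ?_, ?_⟩
  · rintro ⟨x, hx, rfl⟩
    exact absurd (hfr x hx) (not_le.mpr hyR)
  · have hd : 0 < c * R ^ N - ‖y‖ := sub_pos.mpr hyR
    -- By Sard's theorem there is a regular value `z` near `y`; translating `∇P` by `z - y` makes
    -- `y` regular, and the radius keeps the translation below the distance from `y` to the boundary
    -- values.
    obtain ⟨z, hz, hreg⟩ : ∃ z ∈ ball y (c * R ^ N - ‖y‖),
        ∀ x, gradMap P x = z → (fderiv ℝ (gradMap P) x).det ≠ 0 := by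
      by_contra! h
      have hnull := measure_mono_null (fun z hz => by
        obtain ⟨x, hx, hx'⟩ := h z hz
        simp only [mem_compl_iff, mem_ofPred_eq, not_forall, not_not]
        exact ⟨x, hx, hx'⟩) (ae_regular_value hf)
      exact (measure_ball_pos volume y hd).ne' hnull
    refine ⟨fun x => gradMap P x - (z - y), hf.sub contDiff_const, fun x _ w hw => ?_,
      fun x _ hx => ?_⟩
    · rw [sub_sub_cancel_left, norm_neg]
      have h1 : ‖z - y‖ < c * R ^ N - ‖y‖ := by simpa [dist_eq_norm] using hz
      have h2 := hfr w hw
      have h3 := norm_sub_norm_le (gradMap P w) y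
      linarith
    · rw [fderiv_sub_const_fun]
      refine hreg x ?_
      rw [sub_eq_iff_eq_add] at hx
      rw [hx]
      abel
  · intro g hg
    have hU : IsOpen (ball (0 : EuclideanSpace ℝ (Fin 2)) R) := isOpen_ball
    have hb : Bornology.IsBounded (ball (0 : EuclideanSpace ℝ (Fin 2)) R) := isBounded_ball
    have hclose : ∀ x ∈ frontier (ball (0 : EuclideanSpace ℝ (Fin 2)) R),
        ‖(g x - y) - (gradMap P x - y)‖ < ‖gradMap P x - y‖ := fun x hx => by
      rw [sub_sub_sub_cancel_right]
      exact hg.close x (frontier_subset_closure hx) x hx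
    have e1 := eventually_degreeIntegral_eq_signedCount (hg.smooth.sub (contDiff_const (c := y)))
      hU hb (fun x hx => by simpa using add_smul_sub_ne_zero (hclose x hx) (t := 1) (by simp))
      (fun x hx h0 => by
        rw [fderiv_sub_const_fun]
        exact hg.regular x hx (sub_eq_zero.mp h0))
    have e2 := eventually_degreeIntegral_eq_of_homotopy (hf.sub (contDiff_const (c := y)))
      (hg.smooth.sub (contDiff_const (c := y))) hU hb
      (fun x hx t ht => add_smul_sub_ne_zero (hclose x hx) ht)
    have e3 := eventually_degreeIntegral_eq_of_homotopy hf (hf.sub (contDiff_const (c := y))) hU hb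
      (fun x hx t ht => by
        refine add_smul_sub_ne_zero ?_ ht
        rw [sub_sub_cancel_left, norm_neg]
        exact hyR.trans_le (hfr x hx))
    have hcR : 0 < c * R ^ N := by positivity
    -- One `ε` serves for all three identities, and `ε ≤ c * R ^ N` is what the explicit evaluation
    -- for `∇P` needs.
    obtain ⟨ε, h1, h2, h3, hε, hεc⟩ :=
      (e1.and (e2.and (e3.and (Ioc_mem_nhdsGT hcR)))).exists
    have h4 := hP.degreeIntegral_gradMap (R := R) hε (fun x hx => by
      refine hεc.trans (le_trans ?_ (hcP x))
      gcongr)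
    rw [h2, h3, h4, signedCount_sub_const] at h1
    have h5 := mul_right_cancel₀ (integral_radialBump_pos hε).ne' h1
    exact_mod_cast h5.symm

end GradientDegree

/-! ### Stability of nondegenerate solutions -/

section Stability

/-- A nondegenerate solution is stable. -/
theorem isStableSolution_of_det_ne_zero
    {Z : EuclideanSpace ℝ (Fin 2) → EuclideanSpace ℝ (Fin 2)} (hZ : ContDiff ℝ ∞ Z)
    {x₀ : EuclideanSpace ℝ (Fin 2)} (hdet : (fderiv ℝ Z x₀).det ≠ 0) :
    IsStableSolution Z (Z x₀) x₀ := by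
  refine ⟨rfl, fun δ hδ => ?_⟩
  set y := Z x₀ with hy
  obtain ⟨V, hVo, hxV, hinj, -, -⟩ := exists_isOpen_injOn_of_det_ne_zero hZ hdet
  obtain ⟨r₁, hr₁, hr₁V⟩ := nhds_basis_closedBall.mem_iff.mp (hVo.mem_nhds hxV)
  obtain ⟨r, hr, hrr₁, hrδ⟩ : ∃ r > 0, r ≤ r₁ ∧ r < δ :=
    ⟨min r₁ (δ / 2), by positivity, min_le_left _ _, (min_le_right _ _).trans_lt (by linarith)⟩
  have hU : IsOpen (ball x₀ r) := isOpen_ball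
  have hb : Bornology.IsBounded (ball x₀ r) := isBounded_ball
  have hcl : closure (ball x₀ r) = closedBall x₀ r := closure_ball x₀ hr.ne'
  have hfr : frontier (ball x₀ r) = sphere x₀ r := frontier_ball x₀ hr.ne'
  have huniq : ∀ x ∈ closedBall x₀ r, Z x = y → x = x₀ := fun x hx h =>
    hinj (hr₁V (closedBall_subset_closedBall hrr₁ hx)) hxV h
  have hZs : ∀ x ∈ sphere x₀ r, Z x - y ≠ 0 := fun x hx h => by
    rw [huniq x (sphere_subset_closedBall hx) (sub_eq_zero.mp h)] at hx
    simp [hr.ne] at hx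
  obtain ⟨m, hm, hmZ⟩ : ∃ m > 0, ∀ x ∈ sphere x₀ r, m ≤ ‖Z x - y‖ := exists_pos_le_norm_of_isCompact (isCompact_sphere x₀ r)
    (hZ.continuous.sub continuous_const).continuousOn hZs
  refine ⟨m / 2, by positivity, fun W hW hWZ => ?_⟩
  by_contra! hno
  obtain ⟨m', hm', hmW⟩ : ∃ m' > 0, ∀ x ∈ closedBall x₀ r, m' ≤ ‖W x - y‖ := exists_pos_le_norm_of_isCompact (isCompact_closedBall x₀ r)
    (hW.sub continuous_const).continuousOn (fun x hx h => absurd (hno x (sub_eq_zero.mp h))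
      (not_le.mpr (by rw [← dist_eq_norm]; exact (mem_closedBall.mp hx).trans_lt hrδ)))
  -- `W` is only continuous, so it is replaced by a smooth `g`. Closeness `m'` keeps `g - y` without
  -- zeros on the closed ball; closeness `m / 2`, added to the `m / 2` between `W` and `Z`, allows
  -- the homotopy to `Z - y` on the sphere.
  obtain ⟨g, hg, hgW, -⟩ := hW.exists_contDiff_approx ⊤ (ε := fun _ => min m' (m / 2))
    continuous_const (fun _ => by positivity)
  have hg0 : ∀ x ∈ closure (ball x₀ r), g x - y ≠ 0 := fun x hx h => by
    have h1 := hmW x (hcl ▸ hx)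
    have h2 := (hgW x).trans_le (min_le_left _ _)
    rw [sub_eq_zero.mp h, dist_comm, dist_eq_norm] at h2
    linarith
  have hclose : ∀ x ∈ frontier (ball x₀ r), ‖(g x - y) - (Z x - y)‖ < ‖Z x - y‖ := fun x hx => by
    rw [hfr] at hx
    have h1 := hmZ x hx
    have h2 := (hgW x).trans_le (min_le_right _ _)
    have h3 := hWZ x
    rw [dist_eq_norm] at h2
    have h4 := norm_add_le (g x - W x) (W x - Z x)
    rw [sub_add_sub_cancel] at h4
    rw [sub_sub_sub_cancel_right]
    linarith
  have e1 := eventually_degreeIntegral_eq_zero (g := fun x => g x - y)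
    (hg.continuous.sub continuous_const) hb hg0
  have e2 := eventually_degreeIntegral_eq_of_homotopy (hZ.sub (contDiff_const (c := y)))
    (hg.sub (contDiff_const (c := y))) hU hb
    (fun x hx t ht => add_smul_sub_ne_zero (hclose x hx) ht)
  have e3 := eventually_degreeIntegral_eq_signedCount (hZ.sub (contDiff_const (c := y))) hU hb
    (fun x hx => hZs x (hfr ▸ hx)) (fun x hx h => by
      rw [fderiv_sub_const_fun, huniq x (ball_subset_closedBall hx) (sub_eq_zero.mp h)]
      exact hdet)
  obtain ⟨ε, h1, h2, h3, hε⟩ := (e1.and (e2.and (e3.and self_mem_nhdsWithin))).exists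
  -- `x₀` is the only solution in the ball, so the count is `±1`, whereas the absence of zeros of `g
  -- - y` forces it to be 0.
  have hcount : signedCount Z (ball x₀ r) y ≠ 0 := by
    have hset : {x | x ∈ ball x₀ r ∧ Z x = y} = {x₀} := by
      ext x
      constructor
      · rintro ⟨hx, h⟩
        exact huniq x (ball_subset_closedBall hx) h
      · rintro rfl
        exact ⟨mem_ball_self hr, rfl⟩
    rw [signedCount, hset, finsum_mem_singleton]
    rcases hdet.lt_or_gt with h | h
    · simp [sign_neg h]
    · simp [sign_pos h]
  rw [signedCount_sub_const] at h3
  rw [h2, h3] at h1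
  rcases mul_eq_zero.mp h1 with h | h
  · exact hcount (by exact_mod_cast h)
  · exact (integral_radialBump_pos hε).ne' h

variable {N : ℕ} {P : MvPolynomial (Fin 2) ℝ}

/-- At a regular value there are at least as many stable solutions as the degree predicts. -/
theorem IsAdmissiblePoly.natAbs_le_encard_stable (hP : IsAdmissiblePoly N P)
    {y : EuclideanSpace ℝ (Fin 2)}
    (hreg : ∀ x, gradMap P x = y → (fderiv ℝ (gradMap P) x).det ≠ 0) :
    ((1 - ((nodalLines P).ncard : ℤ)).natAbs : ℕ∞) ≤
      Set.encard {ξ | IsStableSolution (gradMap P) y ξ} := by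
  obtain ⟨R, hR, hdeg⟩ := hP.hasBrouwerDegree y
  have hd := hdeg R le_rfl
  have hf := contDiff_gradMap P
  have hfr : ∀ x ∈ frontier (ball (0 : EuclideanSpace ℝ (Fin 2)) R), gradMap P x - y ≠ 0 :=
    fun x hx h => hd.notMem ⟨x, hx, sub_eq_zero.mp h⟩
  have hfin := finite_zeros_of_regular (hf.sub (contDiff_const (c := y))) hd.isBounded hfr
    (fun x _ h => by
      rw [fderiv_sub_const_fun]
      exact hreg x (sub_eq_zero.mp h))
  simp only [sub_eq_zero] at hfin
  -- At a regular value `∇P` is an admissible approximation of itself, so its own signed count is `1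
  -- - M`.
  have hcount := hd.eq_signedCount (gradMap P) ⟨hf, fun x _ z hz => by
    simpa using sub_ne_zero.mp (hfr z hz) |> fun h => sub_ne_zero.mpr h, fun x _ => hreg x⟩
  rw [signedCount, finsum_mem_eq_finite_toFinset_sum _ hfin] at hcount
  rw [← hcount]
  have hle : (∑ x ∈ hfin.toFinset,
      ((SignType.sign (fderiv ℝ (gradMap P) x).det : SignType) : ℤ)).natAbs ≤
        hfin.toFinset.card := by
    refine (Int.natAbs_sum_le _ _).trans ?_
    rw [Finset.card_eq_sum_ones]
    refine Finset.sum_le_sum fun x _ => ?_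
    cases SignType.sign (fderiv ℝ (gradMap P) x).det <;> simp
  calc _ ≤ (hfin.toFinset.card : ℕ∞) := by exact_mod_cast hle
    _ = Set.encard {x | x ∈ ball (0 : EuclideanSpace ℝ (Fin 2)) R ∧ gradMap P x = y} := by
      rw [hfin.encard_eq_coe_toFinset_card]
    _ ≤ _ := by
      refine encard_le_encard fun x hx => ?_
      obtain ⟨-, rfl⟩ := hx
      exact isStableSolution_of_det_ne_zero hf (hreg x rfl)

end Stability

/-! ### Cubics with a degenerate Hessian -/

section Cubic

open MvPolynomial

variable {P : MvPolynomial (Fin 2) ℝ}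

theorem MvPolynomial.IsHomogeneous.exists_linear_eq {Q : MvPolynomial (Fin 2) ℝ}
    (hQ : Q.IsHomogeneous 1) (x : EuclideanSpace ℝ (Fin 2)) :
    polyFun Q x = polyFun (pderiv 0 Q) 0 * x 0 + polyFun (pderiv 1 Q) 0 * x 1 := by
  have h : ∀ i, polyFun (pderiv i Q) x = polyFun (pderiv i Q) 0 := fun i => by
    have := (hQ.pderiv (i := i)).polyFun_smul 0 x
    simpa using this.symm
  have := hQ.euler_polyFun x
  rw [h, h] at this
  push_cast at this
  linarith

/-- Allows the symmetry of second derivatives, known as an identity of functions, to be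
differentiated once more. -/
theorem polyFun_pderiv_congr {Q Q' : MvPolynomial (Fin 2) ℝ}
    (h : ∀ x, polyFun Q x = polyFun Q' x) (i : Fin 2) (x : EuclideanSpace ℝ (Fin 2)) :
    polyFun (pderiv i Q) x = polyFun (pderiv i Q') x := by
  rw [← partialDeriv_polyFun, ← partialDeriv_polyFun, funext h]

/-- A real binary cubic is determined by its four third derivatives. -/
theorem IsAdmissiblePoly.exists_cubic_coeffs (hP : IsAdmissiblePoly 2 P) :
    ∃ a b c d : ℝ, ∀ x,
      6 * polyFun P x = a * x 0 ^ 3 + 3 * b * x 0 ^ 2 * x 1 + 3 * c * x 0 * x 1 ^ 2 + d * x 1 ^ 3 ∧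
      2 * polyFun (pderiv 0 P) x = a * x 0 ^ 2 + 2 * b * x 0 * x 1 + c * x 1 ^ 2 ∧
      2 * polyFun (pderiv 1 P) x = b * x 0 ^ 2 + 2 * c * x 0 * x 1 + d * x 1 ^ 2 ∧
      (fderiv ℝ (gradMap P) x).det =
        (a * x 0 + b * x 1) * (c * x 0 + d * x 1) - (b * x 0 + c * x 1) ^ 2 := by
  refine ⟨polyFun (pderiv 0 (pderiv 0 (pderiv 0 P))) 0, polyFun (pderiv 1 (pderiv 0 (pderiv 0 P))) 0,
    polyFun (pderiv 1 (pderiv 1 (pderiv 0 P))) 0, polyFun (pderiv 1 (pderiv 1 (pderiv 1 P))) 0,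
    fun x => ?_⟩
  have h00 := (hP.isHomogeneous_pderiv_pderiv 0 0).exists_linear_eq x
  have h10 := (hP.isHomogeneous_pderiv_pderiv 1 0).exists_linear_eq x
  have h11 := (hP.isHomogeneous_pderiv_pderiv 1 1).exists_linear_eq x
  rw [polyFun_pderiv_comm (pderiv 0 P)] at h10
  rw [polyFun_pderiv_comm (pderiv 1 P),
    polyFun_pderiv_congr (polyFun_pderiv_comm P) 1] at h11
  have e0 := (hP.isHomogeneous_pderiv 0).euler_polyFun x
  have e1 := (hP.isHomogeneous_pderiv 1).euler_polyFun x
  rw [polyFun_pderiv_comm] at e1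
  have e := hP.homogeneous.euler_polyFun x
  push_cast at e0 e1 e
  rw [h00, h10] at e0
  rw [h10, h11] at e1
  refine ⟨?_, by linear_combination -e0, by linear_combination -e1, ?_⟩
  · linear_combination -2 * e - x 0 * e0 - x 1 * e1
  · rw [det_fderiv_gradMap, h00, h10, h11]

/-- An admissible cubic whose Hessian degenerates off the origin is a combination of two cubes of
linear forms. -/
theorem IsAdmissiblePoly.exists_eq_cube_add_cube (hP : IsAdmissiblePoly 2 P)
    {ξ : EuclideanSpace ℝ (Fin 2)} (hξ : ξ ≠ 0) (hdet : (fderiv ℝ (gradMap P) ξ).det = 0) :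
    ∃ (ζ : EuclideanSpace ℝ (Fin 2)) (A D : ℝ), ξ 0 * ζ 1 - ξ 1 * ζ 0 ≠ 0 ∧ D ≠ 0 ∧
      ∀ α β : ℝ, 6 * polyFun P (α • ξ + β • ζ) = α ^ 3 * A + β ^ 3 * D := by
  obtain ⟨a, b, c, d, hco⟩ := hP.exists_cubic_coeffs
  have hnd : ∀ x : EuclideanSpace ℝ (Fin 2), x ≠ 0 →
      a * x 0 ^ 2 + 2 * b * x 0 * x 1 + c * x 1 ^ 2 = 0 →
      b * x 0 ^ 2 + 2 * c * x 0 * x 1 + d * x 1 ^ 2 = 0 → False := by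
    intro x hx h0 h1
    refine hx ((hP.critical_iff x).mp ?_)
    ext i
    obtain ⟨-, g0, g1, -⟩ := hco x
    rw [gradMap_apply]
    fin_cases i
    · simp only [Fin.zero_eta, PiLp.zero_apply]
      linarith
    · simp only [Fin.mk_one, PiLp.zero_apply]
      linarith
  rw [(hco ξ).2.2.2] at hdet
  set p := ξ 0 with hp
  set q := ξ 1 with hq
  -- Let `T` be the symmetric trilinear form with `T(x, x, x) = 6 P(x)`. The matrix is that of `T(ξ,
  -- ·, ·)`, and its kernel vector gives `ζ` with `T(ξ, ζ, ·) = 0` (`k0`, `k1`). Admissibility is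
  -- `hnd`: `T(x, x, ·) = 0` only for `x = 0`.
  obtain ⟨v, hv0, hv⟩ := Matrix.exists_mulVec_eq_zero_iff.mpr
    (show (!![a * p + b * q, b * p + c * q; b * p + c * q, c * p + d * q]).det = 0 by
      rw [Matrix.det_fin_two_of]
      linarith)
  set s := v 0 with hs
  set t := v 1 with ht
  have k0 : (a * p + b * q) * s + (b * p + c * q) * t = 0 := by
    simpa [Matrix.mulVec, dotProduct, Fin.sum_univ_two] using congrFun hv 0
  have k1 : (b * p + c * q) * s + (c * p + d * q) * t = 0 := by
    simpa [Matrix.mulVec, dotProduct, Fin.sum_univ_two] using congrFun hv 1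
  set ζ : EuclideanSpace ℝ (Fin 2) := !₂[s, t] with hζ
  have hζ0 : ζ ≠ 0 := by
    intro h
    apply hv0
    ext i
    have := congrArg (fun w : EuclideanSpace ℝ (Fin 2) => w i) h
    fin_cases i
    · simpa [hζ] using this
    · simpa [hζ] using this
  -- If `ζ` were parallel to `ξ`, then `T(ξ, ξ, ·)` would vanish.
  have hΔ : p * t - q * s ≠ 0 := by
    intro h
    have hst : s ≠ 0 ∨ t ≠ 0 := by
      by_contra! h'
      apply hζ0
      ext i
      fin_cases i
      · simpa [hζ] using h'.1
      · simpa [hζ] using h'.2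
    rcases hst with h' | h'
    · refine hnd ξ hξ (mul_left_cancel₀ h' ?_) (mul_left_cancel₀ h' ?_)
      · linear_combination p * k0 - (b * p + c * q) * h
      · linear_combination p * k1 - (c * p + d * q) * h
    · refine hnd ξ hξ (mul_left_cancel₀ h' ?_) (mul_left_cancel₀ h' ?_)
      · linear_combination q * k0 + (a * p + b * q) * h
      · linear_combination q * k1 + (b * p + c * q) * h
  set A := a * p ^ 3 + 3 * b * p ^ 2 * q + 3 * c * p * q ^ 2 + d * q ^ 3 with hA
  set D := a * s ^ 3 + 3 * b * s ^ 2 * t + 3 * c * s * t ^ 2 + d * t ^ 3 with hD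
  -- `T(ζ, ζ, ξ) = 0` already; with `T(ζ, ζ, ζ) = 0` as well, `T(ζ, ζ, ·)` would vanish on a basis.
  have hD0 : D ≠ 0 := by
    intro h
    have h1 : (a * s ^ 2 + 2 * b * s * t + c * t ^ 2) * (p * t - q * s) = 0 := by
      linear_combination t * (s * k0 + t * k1) - q * h
    have h2 : (b * s ^ 2 + 2 * c * s * t + d * t ^ 2) * (p * t - q * s) = 0 := by
      linear_combination -s * (s * k0 + t * k1) + p * h
    exact hnd ζ hζ0 ((mul_eq_zero.mp h1).resolve_right hΔ) ((mul_eq_zero.mp h2).resolve_right hΔ)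
  refine ⟨ζ, A, D, hΔ, hD0, fun α β => ?_⟩
  · rw [(hco _).1]
    have z0 : (α • ξ + β • ζ) 0 = α * p + β * s := by simp [hζ, hp]
    have z1 : (α • ξ + β • ζ) 1 = α * q + β * t := by simp [hζ, hq]
    rw [z0, z1]
    -- The mixed terms are multiples of `T(ξ, ξ, ζ)` and `T(ξ, ζ, ζ)`, both 0.
    linear_combination 3 * α ^ 2 * β * (p * k0 + q * k1) + 3 * α * β ^ 2 * (s * k0 + t * k1)

theorem exists_pow_eq_of_odd {n : ℕ} (hn : Odd n) (y : ℝ) : ∃ k : ℝ, k ^ n = y := by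
  have h : Function.Surjective fun x : ℝ => x ^ n :=
    (continuous_pow n).surjective (tendsto_pow_atTop hn.pos.ne')
      ((tendsto_neg_atTop_atBot.comp ((tendsto_pow_atTop hn.pos.ne').comp
        tendsto_neg_atBot_atTop)).congr fun x => by simp [hn.neg_pow])
  exact h y

/-- In the coordinates `α`, `β` the zero set is `β ^ 3 * D = -α ^ 3 * A`. Real cube roots exist and
are unique, so this is the single line `β = k α` with `k ^ 3 = -A / D`. -/
theorem IsAdmissiblePoly.ncard_nodalLines_eq_one (hP : IsAdmissiblePoly 2 P)
    {ξ : EuclideanSpace ℝ (Fin 2)} (hξ : ξ ≠ 0) (hdet : (fderiv ℝ (gradMap P) ξ).det = 0) :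
    (nodalLines P).ncard = 1 := by
  obtain ⟨ζ, A, D, hΔ, hD0, hcube⟩ := hP.exists_eq_cube_add_cube hξ hdet
  have hodd : Odd 3 := ⟨1, rfl⟩
  obtain ⟨k, hk⟩ : ∃ k : ℝ, k ^ 3 = -A / D :=
    exists_pow_eq_of_odd hodd _
  have hkne : ξ + k • ζ ≠ 0 := by
    intro h
    have w0 : ξ 0 + k * ζ 0 = 0 := congrArg (fun w : EuclideanSpace ℝ (Fin 2) => w 0) h
    have w1 : ξ 1 + k * ζ 1 = 0 := congrArg (fun w : EuclideanSpace ℝ (Fin 2) => w 1) h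
    exact hΔ (by linear_combination ζ 1 * w0 - ζ 0 * w1)
  have hcubeD : k ^ 3 * D = -A := by rw [hk, div_mul_cancel₀ _ hD0]
  rw [ncard_eq_one]
  refine ⟨Submodule.span ℝ {ξ + k • ζ}, ?_⟩
  ext L
  rw [mem_singleton_iff]
  constructor
  · rintro ⟨hL1, hL⟩
    obtain ⟨⟨w, hwL⟩, hw0, -⟩ := finrank_eq_one_iff'.mp hL1
    have hw0' : w ≠ 0 := fun h => hw0 (Subtype.ext h)
    obtain ⟨α, β, hαβ⟩ : ∃ α β : ℝ, w = α • ξ + β • ζ := by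
      obtain ⟨α, hα⟩ : ∃ α, α * (ξ 0 * ζ 1 - ξ 1 * ζ 0) = w 0 * ζ 1 - w 1 * ζ 0 :=
        ⟨_, div_mul_cancel₀ _ hΔ⟩
      obtain ⟨β, hβ⟩ : ∃ β, β * (ξ 0 * ζ 1 - ξ 1 * ζ 0) = ξ 0 * w 1 - ξ 1 * w 0 :=
        ⟨_, div_mul_cancel₀ _ hΔ⟩
      refine ⟨α, β, ?_⟩
      ext i
      refine mul_right_cancel₀ hΔ ?_
      fin_cases i <;> simp only [Fin.zero_eta, Fin.mk_one, PiLp.add_apply, PiLp.smul_apply,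
        smul_eq_mul]
      · linear_combination -ξ 0 * hα - ζ 0 * hβ
      · linear_combination -ξ 1 * hα - ζ 1 * hβ
    have h1 := hcube α β
    rw [← hαβ, hL w hwL, mul_zero] at h1
    have hβ : β = k * α := by
      refine hodd.strictMono_pow.injective (mul_right_cancel₀ hD0 ?_)
      linear_combination -h1 - α ^ 3 * hcubeD
    have hw : w = α • (ξ + k • ζ) := by
      rw [hαβ, hβ, smul_add, smul_smul, mul_comm]
    have hα : α ≠ 0 := by
      rintro rfl
      exact hw0' (by rw [hw, zero_smul])
    have hmem : ξ + k • ζ ∈ L := by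
      have : ξ + k • ζ = α⁻¹ • w := by rw [hw, smul_smul, inv_mul_cancel₀ hα, one_smul]
      rw [this]
      exact L.smul_mem _ hwL
    refine (Submodule.eq_of_le_of_finrank_eq
      ((Submodule.span_singleton_le_iff_mem _ _).mpr hmem) ?_).symm
    rw [hL1, finrank_span_singleton hkne]
  · rintro rfl
    refine ⟨finrank_span_singleton hkne, fun w hw => ?_⟩
    obtain ⟨α, rfl⟩ := Submodule.mem_span_singleton.mp hw
    have h1 := hcube 1 k
    rw [one_smul, one_pow, one_mul, hcubeD] at h1
    rw [hP.homogeneous.polyFun_smul, show polyFun P (ξ + k • ζ) = 0 by linarith, mul_zero]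

end Cubic

/-! ### The main theorem -/

theorem mainTheorem4 (N : ℕ) (P : MvPolynomial (Fin 2) ℝ) (hP : IsAdmissiblePoly N P)
    (M : ℕ) (hM : M = (nodalLines P).ncard) :
    ((nodalLines P).Finite ∧ M ≤ N + 1) ∧
    (∀ η₀ : EuclideanSpace ℝ (Fin 2), ∃ R₀ > 0, ∀ R ≥ R₀,
      HasBrouwerDegree (gradMap P) (ball 0 R) η₀ (1 - (M : ℤ))) ∧
    (∀ᵐ η₀ ∂(volume : Measure (EuclideanSpace ℝ (Fin 2))),
      ((1 - (M : ℤ)).natAbs : ℕ∞) ≤ Set.encard {ξ | IsStableSolution (gradMap P) η₀ ξ}) ∧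
    (N = 2 → ∀ η₀ : EuclideanSpace ℝ (Fin 2), η₀ ≠ 0 →
      ((1 - (M : ℤ)).natAbs : ℕ∞) ≤ Set.encard {ξ | IsStableSolution (gradMap P) η₀ ξ}) := by
  subst hM
  refine ⟨hP.finite_nodalLines, hP.hasBrouwerDegree, ?_, ?_⟩
  · filter_upwards [ae_regular_value (contDiff_gradMap P)] with y hy
    exact hP.natAbs_le_encard_stable hy
  · rintro rfl y hy
    -- With a degenerate Hessian off the origin `M = 1`, and the claim is `0 ≤ _`. Otherwise only
    -- the origin can be degenerate, and it is mapped to 0, so the nonzero `y` is a regular value.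
    by_cases h : ∃ ξ : EuclideanSpace ℝ (Fin 2), ξ ≠ 0 ∧ (fderiv ℝ (gradMap P) ξ).det = 0
    · obtain ⟨ξ, hξ, hdet⟩ := h
      rw [hP.ncard_nodalLines_eq_one hξ hdet]
      simp
    · push Not at h
      refine hP.natAbs_le_encard_stable fun x hx => h x ?_
      rintro rfl
      exact hy (hx.symm.trans ((hP.critical_iff 0).mpr rfl))
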